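/- Let $k$ be a field and let $\Gamma$ be a simple graph with vertex set $\{1,\dots,n\}$ and edge set $E$. Let $V$ be the $k$-vector space with basis $\{u_i : 1\le i\le n\}\cup\{u_{ij} : (ij)\in E\}$, where $u_{ij}=u_{ji}$, and put $u_{pq}=0$ for $(pq)\notin E$. Let $Q(\Gamma)$ be the quadratic algebra with space of generators $V$ and, for all pairwise different indices $i,j,k,l$, the relations $$[u_i,u_j]-u_{ij}(u_i-u_j),\qquad [u_i,u_{jk}]+[u_{ik},u_j]+[u_{ik},u_{jk}]-u_{ij}(u_{ik}-u_{jk}),\qquad [u_{ij},u_{kl}],$$ and let $B(\Gamma)$ be the quadratic algebra with the same generators and the relations $$[u_i,u_j],\qquad [u_i,u_{jk}]+[u_{ik},u_j],\qquad [u_{ij},u_{kl}].$$ For a quadratic algebra $A=T(V)/(R)$, $R\subseteq V\otimes V$, let $A^!=T(V^*)/(R^\perp)$ be its quadratic dual, and let $A^!(z)=\sum_d \dim_k (A^!)_d\, z^d$ be the Hilbert series of $A^!$. For $p\ge 0$ let $L_p$ be the set of all $p$-element sets $W$ of pairwise disjoint edges of $\Gamma$, and let $l_p=|L_p|$. For $W\in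 L_p$ let $r_W$ be the number of vertices $m\in\{1,\dots,n\}$ that lie on no edge of $W$ and are such that for every edge $(ij)\in W$ with $i>j$ either $m<i$, or $(mi)\notin E$, or $(mj)\notin E$. Suppose that no two different triangles of $\Gamma$ have a common vertex. Then the Hilbert series of $Q(\Gamma)^!$ and of $B(\Gamma)^!$ are both equal to the polynomial $$p(z)=\sum_{p=0}^{\lfloor n/2\rfloor} z^p\sum_{W\in L_p}(1+z)^{r_W}.$$ In particular, if $\Gamma$ contains no triangle, then $$p(z)=\sum_{p=0}^{\lfloor n/2\rfloor} l_p\, z^p(1+z)^{n-2p}.$$ -/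

import Mathlib

open scoped TensorProduct

/-- The canonical linear map `V ⊗ V → T(V)`, `v ⊗ w ↦ v w`, onto the degree-two part of the tensor
algebra. -/
noncomputable def tensorSquareToAlg (k V : Type*) [Field k] [AddCommGroup V] [Module k V] :
    V ⊗[k] V →ₗ[k] TensorAlgebra k V :=
  LinearMap.mul' k (TensorAlgebra k V) ∘ₗ
    TensorProduct.map (TensorAlgebra.ι k) (TensorAlgebra.ι k)

/-- The quadratic algebra `T(V) / (R)` with space of generators `V` and space of quadratic
relations `R ⊆ V ⊗ V`. -/
abbrev QuadAlg {k V : Type*} [Field k] [AddCommGroup V] [Module k V]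
    (R : Submodule k (V ⊗[k] V)) : Type _ :=
  RingQuot (fun a b : TensorAlgebra k V => ∃ r ∈ R, a = tensorSquareToAlg k V r ∧ b = 0)

namespace QuadAlg

variable {k V : Type*} [Field k] [AddCommGroup V] [Module k V]

/-- The generators of `T(V) / (R)`: the linear map `V → T(V) / (R)`. -/
noncomputable def gen (R : Submodule k (V ⊗[k] V)) : V →ₗ[k] QuadAlg R :=
  (RingQuot.mkAlgHom k
    (fun a b : TensorAlgebra k V =>
      ∃ r ∈ R, a = tensorSquareToAlg k V r ∧ b = 0)).toLinearMap ∘ₗ TensorAlgebra.ι k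

/-- The graded component of degree `d` of `T(V) / (R)`: the span of all products of `d`
generators, that is, the image of `V ^ {⊗ d}`. -/
noncomputable def component (R : Submodule k (V ⊗[k] V)) (d : ℕ) : Submodule k (QuadAlg R) :=
  LinearMap.range (gen R) ^ d

/-- The graded components are finite-dimensional when there are finitely many generators, so that
`Module.finrank` is their dimension. -/
theorem component_finite [Module.Finite k V] (R : Submodule k (V ⊗[k] V)) (d : ℕ) :
    Module.Finite k (component R d) :=
  Module.Finite.iff_fg.mpr ((Module.Finite.iff_fg.mp inferInstance).pow d)

/-- The Hilbert series `∑ dim A_d z ^ d` of the quadratic algebra `A = T(V) / (R)`. -/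
noncomputable def hilbertSeries (R : Submodule k (V ⊗[k] V)) : PowerSeries ℕ :=
  PowerSeries.mk fun d => Module.finrank k (component R d)

/-- The relations of the quadratic dual algebra `A^! = T(V*) / (R^⊥)` of `A = T(V) / (R)`:
`R^⊥ ⊆ V* ⊗ V*` is the annihilator of `R` under the pairing
`⟨f ⊗ g, v ⊗ w⟩ = f v * g w`. -/
noncomputable def dualRel (R : Submodule k (V ⊗[k] V)) :
    Submodule k (Module.Dual k V ⊗[k] Module.Dual k V) :=
  R.dualAnnihilator.comap (TensorProduct.dualDistrib k V V)

end QuadAlg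

namespace GraphAlg

variable (k : Type*) [Field k] {n : ℕ} (Γ : SimpleGraph (Fin n))

/-- The space with basis `u_i` (`i` a vertex) and `u_{ij}` (`ij` an edge, an unordered pair). -/
abbrev Gens : Type _ := (Fin n ⊕ Γ.edgeSet) →₀ k

/-- The generator `u_i`. -/
noncomputable def u (i : Fin n) : Gens k Γ := Finsupp.single (Sum.inl i) 1

open scoped Classical in
/-- The generator `u_{ij}`, with `u_{ij} = 0` when `ij` is not an edge. -/
noncomputable def uu (i j : Fin n) : Gens k Γ :=
  if h : s(i, j) ∈ Γ.edgeSet then Finsupp.single (Sum.inr ⟨s(i, j), h⟩) 1 else 0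

/-- The commutator `[v, w]` as an element of `V ⊗ V`. -/
noncomputable def comm {k V : Type*} [Field k] [AddCommGroup V] [Module k V] (v w : V) :
    V ⊗[k] V :=
  v ⊗ₜ[k] w - w ⊗ₜ[k] v

/-- The space of relations of `Q(Γ)`. -/
noncomputable def relQ : Submodule k (Gens k Γ ⊗[k] Gens k Γ) :=
  Submodule.span k
    ({x | ∃ i j : Fin n, i ≠ j ∧
        x = comm (u k Γ i) (u k Γ j) - uu k Γ i j ⊗ₜ[k] (u k Γ i - u k Γ j)} ∪
     {x | ∃ i j l : Fin n, i ≠ j ∧ i ≠ l ∧ j ≠ l ∧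
        x = comm (u k Γ i) (uu k Γ j l) + comm (uu k Γ i l) (u k Γ j)
          + comm (uu k Γ i l) (uu k Γ j l)
          - uu k Γ i j ⊗ₜ[k] (uu k Γ i l - uu k Γ j l)} ∪
     {x | ∃ i j l m : Fin n, i ≠ j ∧ i ≠ l ∧ i ≠ m ∧ j ≠ l ∧ j ≠ m ∧ l ≠ m ∧
        x = comm (uu k Γ i j) (uu k Γ l m)})

/-- The space of relations of `B(Γ)`. -/
noncomputable def relB : Submodule k (Gens k Γ ⊗[k] Gens k Γ) :=
  Submodule.span k
    ({x | ∃ i j : Fin n, i ≠ j ∧ x = comm (u k Γ i) (u k Γ j)} ∪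
     {x | ∃ i j l : Fin n, i ≠ j ∧ i ≠ l ∧ j ≠ l ∧
        x = comm (u k Γ i) (uu k Γ j l) + comm (uu k Γ i l) (u k Γ j)} ∪
     {x | ∃ i j l m : Fin n, i ≠ j ∧ i ≠ l ∧ i ≠ m ∧ j ≠ l ∧ j ≠ m ∧ l ≠ m ∧
        x = comm (uu k Γ i j) (uu k Γ l m)})

/-- No two different triangles have a common vertex. -/
def NoOverlappingTriangles : Prop :=
  ∀ s t : Finset (Fin n), Γ.IsNClique 3 s → Γ.IsNClique 3 t → s ≠ t → Disjoint s t

open scoped Classical in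
/-- `L_p`: the sets of `p` pairwise disjoint edges. -/
noncomputable def matchings (p : ℕ) : Finset (Finset (Sym2 (Fin n))) :=
  {W | W.card = p ∧ (∀ e ∈ W, e ∈ Γ.edgeSet) ∧
    ∀ e ∈ W, ∀ f ∈ W, e ≠ f → ∀ v, v ∈ e → v ∉ f}

open scoped Classical in
/-- `R_W`: the vertices `m` outside the edges of `W` such that no edge `ij` of `W` with `i > j`
forms a triangle `m, i, j` with `m > i`. -/
noncomputable def admissible (W : Finset (Sym2 (Fin n))) : Finset (Fin n) :=
  {m | (∀ e ∈ W, m ∉ e) ∧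
    ∀ i j : Fin n, s(i, j) ∈ W → j < i → m < i ∨ ¬ Γ.Adj m i ∨ ¬ Γ.Adj m j}

end GraphAlg

/-!
The relations of `Q(Γ)` and `B(Γ)` are the members `ε = 1` and `ε = 0` of one family. In the dual
algebra, generators with disjoint supports anticommute, `u_i` kills every generator that covers `i`,
`u_{ij} b = ε u_i b` whenever `b` covers `j` but not `i`, `u_{ij} u_{ij} = 0`, and
`u_a u_{bc} + u_b u_{ac} + u_c u_{ab} = 0` for every triangle `a < b < c`. Rewriting with the
leading term `u_c u_{ab}` of the last relation shows that the dual algebra is spanned by the reduced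
monomials, those in generators with disjoint supports that contain no such leading term. A reduced
monomial consists of a matching `W` and a set of vertices that count towards `r_W`.

For linear independence the algebra is made to act on a Fock space with one basis vector for each
set of generators. The creation operators, with a correction proportional to `ε` for the edges,
satisfy all relations except those of the triangles. Since the triangles are disjoint, the defects
of their relations commute and can be killed by a single projection, which fixes the basis vectors
of the reduced sets; these vectors are therefore reached, up to sign, by reduced monomials.
-/

namespace QuadAlg

variable {k V E : Type*} [Field k] [AddCommGroup V] [Module k V] [Ring E] [Algebra k E]

/-- The linear map `V ⊗ V → E`, `v ⊗ w ↦ ρ v * ρ w`, whose vanishing on `R` is the condition for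
`ρ` to extend to the quadratic algebra `T(V) / (R)`. -/
noncomputable def mulMap (ρ : V →ₗ[k] E) : V ⊗[k] V →ₗ[k] E :=
  LinearMap.mul' k E ∘ₗ TensorProduct.map ρ ρ

theorem mulMap_tmul (ρ : V →ₗ[k] E) (v w : V) : mulMap ρ (v ⊗ₜ w) = ρ v * ρ w := by
  simp [mulMap]

theorem mulMap_algHom_comp_ι (φ : TensorAlgebra k V →ₐ[k] E) :
    mulMap (φ.toLinearMap ∘ₗ TensorAlgebra.ι k) = φ.toLinearMap ∘ₗ tensorSquareToAlg k V :=
  TensorProduct.ext' fun v w => by simp [mulMap_tmul, tensorSquareToAlg]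

theorem mulMap_gen {R : Submodule k (V ⊗[k] V)} {r : V ⊗[k] V} (hr : r ∈ R) :
    mulMap (gen R) r = 0 := by
  rw [gen, mulMap_algHom_comp_ι]
  have h := RingQuot.mkAlgHom_rel k
    (s := fun a b : TensorAlgebra k V => ∃ r ∈ R, a = tensorSquareToAlg k V r ∧ b = 0)
    ⟨r, hr, rfl, rfl⟩
  simpa using h

/-- The universal property of `T(V) / (R)`. -/
noncomputable def lift (R : Submodule k (V ⊗[k] V)) (ρ : V →ₗ[k] E)
    (h : R ≤ LinearMap.ker (mulMap ρ)) : QuadAlg R →ₐ[k] E :=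
  RingQuot.liftAlgHom k ⟨TensorAlgebra.lift k ρ, by
    rintro _ _ ⟨r, hr, rfl, rfl⟩
    have hρ : (TensorAlgebra.lift k ρ).toLinearMap ∘ₗ TensorAlgebra.ι k = ρ :=
      LinearMap.ext fun v => TensorAlgebra.lift_ι_apply ρ v
    have hr0 : mulMap ρ r = 0 := h hr
    rw [← hρ, mulMap_algHom_comp_ι] at hr0
    simpa using hr0⟩

theorem lift_gen (R : Submodule k (V ⊗[k] V)) (ρ : V →ₗ[k] E)
    (h : R ≤ LinearMap.ker (mulMap ρ)) (v : V) : lift R ρ h (gen R v) = ρ v := by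
  simp [lift, gen]

end QuadAlg

namespace GraphAlg

variable {k : Type*} [Field k] {n : ℕ} {Γ : SimpleGraph (Fin n)}

variable (Γ) in
/-- The index set of the generators: the vertices and the edges. -/
abbrev Gen : Type := Fin n ⊕ Γ.edgeSet

/-- The vertices covered by a generator: `{i}` for `u_i` and `{i, j}` for `u_{ij}`. -/
def support : Gen Γ → Finset (Fin n)
  | Sum.inl i => {i}
  | Sum.inr e => e.1.toFinset

theorem mem_support_inl {i v : Fin n} : v ∈ support (Sum.inl i : Gen Γ) ↔ v = i :=
  Finset.mem_singleton

theorem mem_support_inr {e : Γ.edgeSet} {v : Fin n} :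
    v ∈ support (Sum.inr e : Gen Γ) ↔ v ∈ e.1 :=
  Sym2.mem_toFinset

theorem support_nonempty (a : Gen Γ) : (support a).Nonempty := by
  rcases a with i | ⟨⟨i, j⟩, h⟩
  · exact ⟨i, mem_support_inl.mpr rfl⟩
  · exact ⟨i, mem_support_inr.mpr (Sym2.mem_mk_left i j)⟩

variable (Γ) in
/-- A triangle of `Γ`, with its vertices listed in increasing order. -/
structure Triangle where
  a : Fin n
  b : Fin n
  c : Fin n
  a_lt_b : a < b
  b_lt_c : b < c
  adj_ab : Γ.Adj a b
  adj_bc : Γ.Adj b c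
  adj_ac : Γ.Adj a c

namespace Triangle

variable (T : Triangle Γ)

/-- The side opposite to the largest vertex. -/
def ab : Γ.edgeSet := ⟨s(T.a, T.b), T.adj_ab⟩

/-- The side opposite to the smallest vertex. -/
def bc : Γ.edgeSet := ⟨s(T.b, T.c), T.adj_bc⟩

/-- The side opposite to the middle vertex. -/
def ac : Γ.edgeSet := ⟨s(T.a, T.c), T.adj_ac⟩

end Triangle

/-- The vertex `i` forms a triangle with the edge `e` in which `i` is the largest vertex. -/
def Caps (i : Fin n) (e : Γ.edgeSet) : Prop :=
  ∀ v ∈ e.1, v < i ∧ Γ.Adj v i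

theorem Triangle.caps (T : Triangle Γ) : Caps T.c T.ab := by
  have h₁ := T.a_lt_b
  have h₂ := T.b_lt_c
  have h₃ := T.adj_bc
  have h₄ := T.adj_ac
  simp only [Caps, Triangle.ab, Sym2.mem_iff]
  grind

theorem Caps.exists_triangle {i : Fin n} {e : Γ.edgeSet} (h : Caps i e) :
    ∃ T : Triangle Γ, i = T.c ∧ e = T.ab := by
  obtain ⟨⟨a, b⟩, hab⟩ := e
  obtain ⟨ha, hai⟩ := h a (Sym2.mem_mk_left a b)
  obtain ⟨hb, hbi⟩ := h b (Sym2.mem_mk_right a b)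
  rcases lt_or_gt_of_ne (Γ.ne_of_adj hab) with hlt | hlt
  · exact ⟨⟨a, b, i, hlt, hb, hab, hbi, hai⟩, rfl, rfl⟩
  · exact ⟨⟨b, a, i, hlt, ha, hab.symm, hai, hbi⟩, rfl, Subtype.ext Sym2.eq_swap⟩

variable (k Γ) in
/-- The interpolation between the relations of `Q(Γ)`, at `ε = 1`, and of `B(Γ)`, at `ε = 0`. -/
noncomputable def rel (ε : k) : Submodule k (Gens k Γ ⊗[k] Gens k Γ) :=
  Submodule.span k
    ({x | ∃ i j : Fin n, i ≠ j ∧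
        x = comm (u k Γ i) (u k Γ j) - ε • (uu k Γ i j ⊗ₜ[k] (u k Γ i - u k Γ j))} ∪
     {x | ∃ i j l : Fin n, i ≠ j ∧ i ≠ l ∧ j ≠ l ∧
        x = comm (u k Γ i) (uu k Γ j l) + comm (uu k Γ i l) (u k Γ j)
          + ε • (comm (uu k Γ i l) (uu k Γ j l)
          - uu k Γ i j ⊗ₜ[k] (uu k Γ i l - uu k Γ j l))} ∪
     {x | ∃ i j l m : Fin n, i ≠ j ∧ i ≠ l ∧ i ≠ m ∧ j ≠ l ∧ j ≠ m ∧ l ≠ m ∧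
        x = comm (uu k Γ i j) (uu k Γ l m)})

theorem relQ_eq_rel : relQ k Γ = rel k Γ 1 := by
  have assoc (x y z : Gens k Γ ⊗[k] Gens k Γ) : x + y - z = x + (y - z) := add_sub_assoc x y z
  simp only [relQ, rel, one_smul, assoc]

theorem relB_eq_rel : relB k Γ = rel k Γ 0 := by
  have sub_zero' (x : Gens k Γ ⊗[k] Gens k Γ) : x - 0 = x := sub_zero x
  simp only [relB, rel, zero_smul, sub_zero', add_zero]

/-- The functional on `V` reading off the coordinate of a generator. -/
noncomputable def coord (a : Gen Γ) : Module.Dual k (Gens k Γ) :=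
  Finsupp.lapply a

theorem coord_inl_u (i j : Fin n) :
    coord (Sum.inl i) (u k Γ j) = if j = i then 1 else 0 := by
  classical
  simp [coord, u, Finsupp.single_apply]

theorem coord_inl_uu (i j l : Fin n) : coord (Sum.inl i) (uu k Γ j l) = 0 := by
  unfold uu
  split_ifs <;> simp [coord]

theorem coord_inr_u (e : Γ.edgeSet) (j : Fin n) : coord (Sum.inr e) (u k Γ j) = 0 := by
  simp [coord, u]

theorem coord_inr_uu (e : Γ.edgeSet) (j l : Fin n) :
    coord (Sum.inr e) (uu k Γ j l) = if s(j, l) = e.1 then 1 else 0 := by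
  classical
  by_cases h : s(j, l) ∈ Γ.edgeSet
  · simp [uu, coord, h, Finsupp.single_apply, Subtype.ext_iff]
  · have hne : s(j, l) ≠ e.1 := fun he => h (he ▸ e.2)
    simp [uu, h, hne]

/-- The relations satisfied by the products `m a b` of the generators `a` and `b` of the quadratic
dual. The elements of `Gen Γ` index the basis dual to the `u_i` and `u_{ij}`. -/
structure IsDualForm {M : Type*} [AddCommGroup M] [Module k M] (ε : k) (m : Gen Γ → Gen Γ → M) :
    Prop where
  anticomm : ∀ a b, Disjoint (support a) (support b) → m a b = -m b a
  vertex : ∀ i b, i ∈ support b → m (Sum.inl i) b = 0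
  edge : ∀ i j (h : Γ.Adj i j) b, i ∉ support b → j ∈ support b →
    m (Sum.inr ⟨s(i, j), h⟩) b = ε • m (Sum.inl i) b
  edge_self : ∀ e, m (Sum.inr e) (Sum.inr e) = 0
  triangle : ∀ T : Triangle Γ, m (Sum.inl T.a) (Sum.inr T.bc) + m (Sum.inl T.b) (Sum.inr T.ac) +
    m (Sum.inl T.c) (Sum.inr T.ab) = 0

namespace IsDualForm

variable {M N : Type*} [AddCommGroup M] [Module k M] [AddCommGroup N] [Module k N] {ε : k}

theorem map {m : Gen Γ → Gen Γ → M} (hm : IsDualForm ε m) (f : M →ₗ[k] N) :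
    IsDualForm ε fun a b => f (m a b) where
  anticomm a b h := by rw [hm.anticomm a b h, map_neg]
  vertex i b h := by rw [hm.vertex i b h, map_zero]
  edge i j h b hi hj := by rw [hm.edge i j h b hi hj, map_smul]
  edge_self e := by rw [hm.edge_self e, map_zero]
  triangle T := by rw [← map_add, ← map_add, hm.triangle T, map_zero]

end IsDualForm

variable (Γ) in
/-- The space of all forms with values in `M` that satisfy the relations of the quadratic dual. -/
def dualForms (ε : k) (M : Type*) [AddCommGroup M] [Module k M] :
    Submodule k (Gen Γ → Gen Γ → M) where
  carrier := {m | IsDualForm ε m}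
  zero_mem' := by constructor <;> simp
  add_mem' {m m'} hm hm' :=
    { anticomm a b h := by simp [hm.anticomm a b h, hm'.anticomm a b h, add_comm]
      vertex i b h := by simp [hm.vertex i b h, hm'.vertex i b h]
      edge i j h b hi hj := by simp [hm.edge i j h b hi hj, hm'.edge i j h b hi hj]
      edge_self e := by simp [hm.edge_self e, hm'.edge_self e]
      triangle T := by
        have h := congrArg₂ (· + ·) (hm.triangle T) (hm'.triangle T)
        simp only [add_zero] at h
        rw [← h]
        simp only [Pi.add_apply]
        abel }
  smul_mem' t _ hm := hm.map (LinearMap.lsmul k M t)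

theorem gen_cases {motive : Gen Γ → Prop} (vertex : ∀ i, motive (Sum.inl i))
    (edge : ∀ i j (h : Γ.Adj i j), motive (Sum.inr ⟨s(i, j), h⟩)) (a : Gen Γ) : motive a := by
  rcases a with i | ⟨⟨i, j⟩, h⟩
  exacts [vertex i, edge i j h]

/-- The functional on `V ⊗ V` reading off the coefficient of the tensor of two generators. -/
noncomputable def coeff (a b : Gen Γ) : Module.Dual k (Gens k Γ ⊗[k] Gens k Γ) :=
  TensorProduct.dualDistrib k _ _ (coord a ⊗ₜ coord b)

theorem coeff_tmul (a b : Gen Γ) (v w : Gens k Γ) :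
    coeff a b (v ⊗ₜ[k] w) = coord a v * coord b w :=
  TensorProduct.dualDistrib_apply _ _ _ _

/-- The linear map taking a tensor to its array of coefficients. -/
noncomputable def coeffForm : Gens k Γ ⊗[k] Gens k Γ →ₗ[k] Gen Γ → Gen Γ → k :=
  LinearMap.pi fun a => LinearMap.pi fun b => coeff a b

theorem mem_comap_dualForms {ε : k} {r : Gens k Γ ⊗[k] Gens k Γ} :
    r ∈ (dualForms Γ ε k).comap coeffForm ↔ IsDualForm ε fun a b => coeff a b r :=
  Iff.rfl

theorem isDualForm_coeff_of_mem_rel {ε : k} {r : Gens k Γ ⊗[k] Gens k Γ} (hr : r ∈ rel k Γ ε) :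
    IsDualForm ε fun a b => coeff a b r := by
  have h_le : rel k Γ ε ≤ (dualForms Γ ε k).comap coeffForm := by
    refine Submodule.span_le.mpr fun r hr => ?_
    rcases hr with (⟨i, j, hij, rfl⟩ | ⟨i, j, l, hij, hil, hjl, rfl⟩) |
      ⟨i, j, l, m, hij, hil, him, hjl, hjm, hlm, rfl⟩
    all_goals
      rw [SetLike.mem_coe, mem_comap_dualForms]
      simp only [comm, map_sub, map_add, map_smul, TensorProduct.tmul_sub, coeff_tmul]
      constructor
      · rintro (a | ⟨⟨a, a'⟩, ha⟩) (b | ⟨⟨b, b'⟩, hb⟩) hab <;>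
        simp only [Finset.disjoint_left, mem_support_inl, mem_support_inr, Sym2.mem_iff,
          coord_inl_u, coord_inl_uu, coord_inr_u, coord_inr_uu, Sym2.eq_iff,
          smul_eq_mul] at hab ⊢ <;>
        grind
      · rintro i (b | ⟨⟨b, b'⟩, hb⟩) hib <;>
        simp only [mem_support_inl, mem_support_inr, Sym2.mem_iff,
          coord_inl_u, coord_inl_uu, coord_inr_u, coord_inr_uu, Sym2.eq_iff,
          smul_eq_mul] at hib ⊢ <;>
        grind [SimpleGraph.ne_of_adj]
      · rintro i j hij (b | ⟨⟨b, b'⟩, hb⟩) hib <;>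
        simp only [mem_support_inl, mem_support_inr, Sym2.mem_iff,
          coord_inl_u, coord_inl_uu, coord_inr_u, coord_inr_uu, Sym2.eq_iff,
          smul_eq_mul] at hib ⊢ <;>
        grind [SimpleGraph.ne_of_adj]
      · rintro ⟨⟨b, b'⟩, hb⟩
        simp only [coord_inr_u, coord_inr_uu, Sym2.eq_iff, smul_eq_mul]
        grind [SimpleGraph.ne_of_adj]
      · rintro ⟨a, b, c, h₁, h₂, h₃, h₄, h₅⟩
        simp only [Triangle.ab, Triangle.bc, Triangle.ac, coord_inl_u, coord_inl_uu, coord_inr_u,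
          coord_inr_uu, Sym2.eq_iff, smul_eq_mul]
        grind [SimpleGraph.ne_of_adj]
  exact h_le hr

/-- A choice of pairs of generators whose products span all products of two generators of the
quadratic dual. -/
def Normal : Gen Γ → Gen Γ → Prop
  | Sum.inl i, Sum.inl j => i < j
  | Sum.inl i, Sum.inr e => i ∉ e.1 ∧ ¬ Caps i e
  | Sum.inr _, Sum.inl _ => False
  | Sum.inr e, Sum.inr f =>
    Disjoint (support (Sum.inr e)) (support (Sum.inr f)) ∧ WellOrderingRel e f

theorem exists_eq_mk_of_not_disjoint {e : Γ.edgeSet} {b : Gen Γ} (hne : b ≠ Sum.inr e)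
    (h : ¬ Disjoint (support (Sum.inr e)) (support b)) :
    ∃ i j, ∃ hij : Γ.Adj i j, e = ⟨s(i, j), hij⟩ ∧ i ∉ support b ∧ j ∈ support b := by
  obtain ⟨j, hje, hjb⟩ := Finset.not_disjoint_iff.mp h
  obtain ⟨i, hi⟩ := Sym2.mem_iff_exists.mp (mem_support_inr.mp hje)
  have he : e.1 = s(i, j) := hi.trans Sym2.eq_swap
  have hij : Γ.Adj i j := Γ.mem_edgeSet.mp (he ▸ e.2)
  refine ⟨i, j, hij, Subtype.ext he, fun hib => ?_, hjb⟩
  rcases b with v | f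
  · exact hij.ne ((mem_support_inl.mp hib).trans (mem_support_inl.mp hjb).symm)
  · have hf := (Sym2.mem_and_mem_iff hij.ne).mp ⟨mem_support_inr.mp hib, mem_support_inr.mp hjb⟩
    exact hne (congrArg Sum.inr (Subtype.ext (hf.trans he.symm)))

namespace IsDualForm

variable {M : Type*} [AddCommGroup M] [Module k M] {ε : k} {m : Gen Γ → Gen Γ → M}

theorem vertex_vertex_eq_zero (hm : IsDualForm ε m) (h : ∀ a b, Normal a b → m a b = 0)
    (i j : Fin n) : m (Sum.inl i) (Sum.inl j) = 0 := by
  rcases lt_trichotomy i j with hij | rfl | hij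
  · exact h _ _ hij
  · exact hm.vertex i _ (mem_support_inl.mpr rfl)
  · have hdisj : Disjoint (support (Sum.inl i : Gen Γ)) (support (Sum.inl j : Gen Γ)) :=
      Finset.disjoint_singleton.mpr hij.ne'
    rw [hm.anticomm _ _ hdisj, h (Sum.inl j) (Sum.inl i) hij, neg_zero]

theorem vertex_edge_eq_zero (hm : IsDualForm ε m) (h : ∀ a b, Normal a b → m a b = 0)
    (i : Fin n) (e : Γ.edgeSet) : m (Sum.inl i) (Sum.inr e) = 0 := by
  by_cases hie : i ∈ e.1
  · exact hm.vertex i _ (mem_support_inr.mpr hie)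
  by_cases hcaps : Caps i e
  · obtain ⟨T, rfl, rfl⟩ := hcaps.exists_triangle
    have hlt₁ := T.a_lt_b
    have hlt₂ := T.b_lt_c
    have ha : Normal (Sum.inl T.a) (Sum.inr T.bc) := by
      refine ⟨?_, fun h => (h T.c (Sym2.mem_mk_right _ _)).1.asymm (hlt₁.trans hlt₂)⟩
      simp [Triangle.bc, hlt₁.ne, (hlt₁.trans hlt₂).ne]
    have hb : Normal (Sum.inl T.b) (Sum.inr T.ac) := by
      refine ⟨?_, fun h => (h T.c (Sym2.mem_mk_right _ _)).1.asymm hlt₂⟩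
      simp [Triangle.ac, hlt₁.ne', hlt₂.ne]
    simpa [h _ _ ha, h _ _ hb] using hm.triangle T
  · exact h _ _ ⟨hie, hcaps⟩

theorem eq_zero_of_normal (hm : IsDualForm ε m) (h : ∀ a b, Normal a b → m a b = 0)
    (a b : Gen Γ) : m a b = 0 := by
  have vertex_eq_zero (i : Fin n) (b : Gen Γ) : m (Sum.inl i) b = 0 := by
    rcases b with j | f
    exacts [hm.vertex_vertex_eq_zero h i j, hm.vertex_edge_eq_zero h i f]
  rcases a with i | e
  · exact vertex_eq_zero i b
  by_cases hbe : b = Sum.inr e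
  · rw [hbe, hm.edge_self]
  by_cases hdisj : Disjoint (support (Sum.inr e)) (support b)
  · rcases b with j | f
    · rw [hm.anticomm _ _ hdisj, vertex_eq_zero, neg_zero]
    · rcases trichotomous_of WellOrderingRel e f with hef | rfl | hfe
      · exact h _ _ ⟨hdisj, hef⟩
      · exact absurd rfl hbe
      · rw [hm.anticomm _ _ hdisj, h (Sum.inr f) (Sum.inr e) ⟨hdisj.symm, hfe⟩, neg_zero]
  · obtain ⟨i, j, hij, rfl, hi, hj⟩ := exists_eq_mk_of_not_disjoint hbe hdisj
    rw [hm.edge i j hij b hi hj, vertex_eq_zero, smul_zero]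

end IsDualForm

variable (k Γ) in
/-- The relation of the second kind, with leading term `u_i ⊗ u_{jl}`. -/
noncomputable def vertexEdgeRel (ε : k) (i j l : Fin n) : Gens k Γ ⊗[k] Gens k Γ :=
  comm (u k Γ i) (uu k Γ j l) + comm (uu k Γ i l) (u k Γ j)
    + ε • (comm (uu k Γ i l) (uu k Γ j l) - uu k Γ i j ⊗ₜ[k] (uu k Γ i l - uu k Γ j l))

theorem coeff_vertexEdgeRel (ε : k) {i j l : Fin n} (hij : i ≠ j) (hil : i ≠ l) (hjl : Γ.Adj j l)
    (h : Γ.Adj i l → i < j ∧ l < j ∧ Γ.Adj i j) {c d : Gen Γ} (hcd : Normal c d) :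
    coeff c d (vertexEdgeRel k Γ ε i j l) =
      if Sum.inl i = c ∧ Sum.inr ⟨s(j, l), hjl⟩ = d then 1 else 0 := by
  cases c using gen_cases <;> cases d using gen_cases <;>
  simp only [vertexEdgeRel, comm, map_sub, map_add, map_smul, TensorProduct.tmul_sub, coeff_tmul,
    coord_inl_u, coord_inl_uu, coord_inr_u, coord_inr_uu, Sym2.eq_iff, smul_eq_mul, Sum.inl.injEq,
    Sum.inr.injEq, reduceCtorEq] <;>
  simp only [Normal, Caps, Finset.disjoint_left, mem_support_inr, Sym2.mem_iff, forall_eq_or_imp,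
    forall_eq] at hcd <;>
  grind [Γ.adj_comm]

theorem exists_leading_relation_vertex_edge (ε : k) {i j l : Fin n} (hjl : Γ.Adj j l)
    (hnormal : Normal (Sum.inl i) (Sum.inr ⟨s(j, l), hjl⟩ : Gen Γ)) :
    ∃ r ∈ rel k Γ ε, ∀ c d, Normal c d →
      coeff c d r = if Sum.inl i = c ∧ Sum.inr ⟨s(j, l), hjl⟩ = d then 1 else 0 := by
  have vertexEdgeRel_mem (j l : Fin n) (hij : i ≠ j) (hil : i ≠ l) (hjl : Γ.Adj j l) :
      vertexEdgeRel k Γ ε i j l ∈ rel k Γ ε :=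
    Submodule.subset_span (Or.inl (Or.inr ⟨i, j, l, hij, hil, hjl.ne, rfl⟩))
  simp only [Normal, Caps, Sym2.mem_iff, not_or, forall_eq_or_imp, forall_eq] at hnormal
  obtain ⟨⟨hij, hil⟩, hcaps⟩ := hnormal
  have hjl_ne := hjl.ne
  -- Of the two relations with leading term `u_i ⊗ u_{jl}`, take the one whose other tensor of a
  -- vertex and an edge, `u_j ⊗ u_{il}` or `u_l ⊗ u_{ij}`, is not normal.
  by_cases hj : Γ.Adj i l → i < j ∧ l < j ∧ Γ.Adj i j
  · exact ⟨_, vertexEdgeRel_mem j l hij hil hjl,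
      fun c d => coeff_vertexEdgeRel ε hij hil hjl hj⟩
  · have hl : Γ.Adj i j → i < l ∧ j < l ∧ Γ.Adj i l := by grind [Γ.adj_comm]
    refine ⟨_, vertexEdgeRel_mem l j hil hij hjl.symm, fun c d hcd => ?_⟩
    simpa only [Sym2.eq_swap] using coeff_vertexEdgeRel ε hil hij hjl.symm hl hcd

theorem exists_leading_relation (ε : k) {a b : Gen Γ} (hab : Normal a b) :
    ∃ r ∈ rel k Γ ε, ∀ c d, Normal c d → coeff c d r = if a = c ∧ b = d then 1 else 0 := by
  cases a using gen_cases with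
  | vertex i =>
    cases b using gen_cases with
    | vertex j =>
      refine ⟨_, Submodule.subset_span (Or.inl (Or.inl ⟨i, j, ne_of_lt hab, rfl⟩)), ?_⟩
      intro c d hcd
      cases c using gen_cases <;> cases d using gen_cases <;>
      simp only [comm, map_sub, map_smul, TensorProduct.tmul_sub, coeff_tmul,
        coord_inl_u, coord_inl_uu, coord_inr_u, coord_inr_uu, Sym2.eq_iff, smul_eq_mul] <;>
      simp only [Normal] at hcd hab <;> grind
    | edge j l hjl => exact exists_leading_relation_vertex_edge ε hjl hab
  | edge i j hij =>
    cases b using gen_cases with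
    | vertex => exact hab.elim
    | edge l m hlm =>
      obtain ⟨hdisj, hlt⟩ := hab
      have hne : i ≠ l ∧ i ≠ m ∧ j ≠ l ∧ j ≠ m := by
        simpa [Finset.disjoint_left, mem_support_inr, not_or, and_assoc] using hdisj
      refine ⟨_, Submodule.subset_span (Or.inr ⟨i, j, l, m, hij.ne, hne.1, hne.2.1, hne.2.2.1,
        hne.2.2.2, hlm.ne, rfl⟩), ?_⟩
      intro c d hcd
      have hasymm := asymm_of (WellOrderingRel (α := Γ.edgeSet)) hlt
      rcases c with c | c <;> rcases d with d | d <;>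
      simp only [comm, map_sub, coeff_tmul, coord_inl_uu, coord_inr_uu, Sum.inr.injEq, reduceCtorEq,
        Subtype.ext_iff]
      all_goals simp only [Normal] at hcd
      all_goals grind

theorem IsDualForm.exists_eq_sum {M : Type*} [AddCommGroup M] [Module k M] {ε : k}
    {m : Gen Γ → Gen Γ → M} (hm : IsDualForm ε m) :
    ∃ (s : Finset (Gen Γ × Gen Γ)) (r : Gen Γ × Gen Γ → rel k Γ ε),
      ∀ a b, m a b = ∑ p ∈ s, coeff a b (r p).1 • m p.1 p.2 := by
  classical
  have hr (p : Gen Γ × Gen Γ) : ∃ r : rel k Γ ε, Normal p.1 p.2 → ∀ c d, Normal c d →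
      coeff c d r.1 = if p.1 = c ∧ p.2 = d then (1 : k) else 0 := by
    by_cases hp : Normal p.1 p.2
    · obtain ⟨r, hr, hcoeff⟩ := exists_leading_relation ε hp
      exact ⟨⟨r, hr⟩, fun _ => hcoeff⟩
    · exact ⟨0, fun h => absurd h hp⟩
  choose r hr using hr
  let s := (Set.toFinite {p : Gen Γ × Gen Γ | Normal p.1 p.2}).toFinset
  have hs (p) : p ∈ s ↔ Normal p.1 p.2 := Set.Finite.mem_toFinset _
  have hsum : (fun a b => ∑ p ∈ s, coeff a b (r p).1 • m p.1 p.2) ∈ dualForms Γ ε M := by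
    convert Submodule.sum_mem (dualForms Γ ε M) (t := s) fun p _ =>
      (isDualForm_coeff_of_mem_rel (r p).2).map (LinearMap.toSpanSingleton k M (m p.1 p.2))
    simp
  refine ⟨s, r, fun a b => sub_eq_zero.mp <|
    IsDualForm.eq_zero_of_normal (sub_mem (show m ∈ dualForms Γ ε M from hm) hsum) ?_ a b⟩
  intro c d hcd
  have hterm : ∀ p ∈ s, coeff c d (r p).1 • m p.1 p.2 = if p = (c, d) then m c d else 0 := by
    rintro ⟨a, b⟩ hp
    rw [hr _ ((hs _).mp hp) c d hcd]
    simp only [Prod.mk.injEq]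
    split_ifs with h
    · rw [h.1, h.2, one_smul]
    · exact zero_smul k _
  have hmem : (c, d) ∈ s := (hs _).mpr hcd
  simp [Finset.sum_congr rfl hterm, hmem]

variable (k Γ) in
/-- The generators of the quadratic dual: the basis of `V*` dual to the `u_i` and `u_{ij}`. -/
noncomputable def coordBasis : Module.Basis (Gen Γ) k (Module.Dual k (Gens k Γ)) :=
  open scoped Classical in Finsupp.basisSingleOne.dualBasis

theorem coordBasis_apply (a : Gen Γ) : coordBasis k Γ a = coord a := by
  classical
  ext v
  simp [coordBasis, coord]

theorem tensor_hom_ext {M : Type*} [AddCommGroup M] [Module k M]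
    {F G : Module.Dual k (Gens k Γ) ⊗[k] Module.Dual k (Gens k Γ) →ₗ[k] M}
    (h : ∀ a b : Gen Γ, F (coord a ⊗ₜ coord b) = G (coord a ⊗ₜ coord b)) : F = G := by
  refine ((coordBasis k Γ).tensorProduct (coordBasis k Γ)).ext fun ⟨a, b⟩ => ?_
  simpa only [Module.Basis.tensorProduct_apply, coordBasis_apply] using h a b

theorem IsDualForm.dualRel_le_ker {M : Type*} [AddCommGroup M] [Module k M] {ε : k}
    {F : Module.Dual k (Gens k Γ) ⊗[k] Module.Dual k (Gens k Γ) →ₗ[k] M}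
    (hF : IsDualForm ε fun a b => F (coord a ⊗ₜ coord b)) :
    QuadAlg.dualRel (rel k Γ ε) ≤ LinearMap.ker F := by
  intro f hf
  obtain ⟨s, r, hsum⟩ := hF.exists_eq_sum
  have hF_eq : F = ∑ p ∈ s, LinearMap.toSpanSingleton k M (F (coord p.1 ⊗ₜ coord p.2)) ∘ₗ
      (TensorProduct.dualDistrib k (Gens k Γ) (Gens k Γ)).flip (r p).1 :=
    tensor_hom_ext fun a b => by simpa using! hsum a b
  rw [LinearMap.mem_ker, hF_eq, LinearMap.sum_apply]
  refine Finset.sum_eq_zero fun p _ => ?_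
  have hp : TensorProduct.dualDistrib k _ _ f (r p).1 = 0 :=
    (Submodule.mem_dualAnnihilator _).mp (Submodule.mem_comap.mp hf) _ (r p).2
  simp [hp]

theorem isDualForm_of_dualRel_le_ker {M : Type*} [AddCommGroup M] [Module k M] {ε : k}
    {F : Module.Dual k (Gens k Γ) ⊗[k] Module.Dual k (Gens k Γ) →ₗ[k] M}
    (hF : QuadAlg.dualRel (rel k Γ ε) ≤ LinearMap.ker F) :
    IsDualForm ε fun a b => F (coord a ⊗ₜ coord b) := by
  have eq_zero (f) (hf : ∀ r ∈ rel k Γ ε, TensorProduct.dualDistrib k _ _ f r = 0) : F f = 0 :=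
    hF (Submodule.mem_comap.mpr ((Submodule.mem_dualAnnihilator _).mpr hf))
  have form {r} (hr : r ∈ rel k Γ ε) := isDualForm_coeff_of_mem_rel hr
  simp only [coeff] at form
  refine ⟨fun a b h => ?_, fun i b h => ?_, fun i j h b hi hj => ?_, fun e => ?_, fun T => ?_⟩
  · rw [eq_neg_iff_add_eq_zero, ← map_add]
    exact eq_zero _ fun r hr => by simp [(form hr).anticomm a b h]
  · exact eq_zero _ fun r hr => (form hr).vertex i b h
  · rw [← sub_eq_zero, ← map_smul, ← map_sub]
    exact eq_zero _ fun r hr => by simp [(form hr).edge i j h b hi hj]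
  · exact eq_zero _ fun r hr => (form hr).edge_self e
  · rw [← map_add, ← map_add]
    exact eq_zero _ fun r hr => by simpa using (form hr).triangle T

section DualSystem

variable {E : Type*} [Ring E] [Algebra k E] {ε : k}

/-- A family of elements of an algebra that satisfies the relations of the quadratic dual. -/
def IsDualSystem (ε : k) (g : Gen Γ → E) : Prop :=
  IsDualForm ε fun a b => g a * g b

/-- The generators of the quadratic dual of the algebra with relations `rel k Γ ε`. -/
noncomputable def dualGen (ε : k) (a : Gen Γ) : QuadAlg (QuadAlg.dualRel (rel k Γ ε)) :=
  QuadAlg.gen _ (coord a)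

theorem isDualSystem_dualGen (ε : k) : IsDualSystem ε (dualGen ε : Gen Γ → _) := by
  have h_le : QuadAlg.dualRel (rel k Γ ε) ≤
      LinearMap.ker (QuadAlg.mulMap (QuadAlg.gen (QuadAlg.dualRel (rel k Γ ε)))) :=
    fun r hr => QuadAlg.mulMap_gen hr
  simpa only [QuadAlg.mulMap_tmul] using! isDualForm_of_dualRel_le_ker h_le

namespace IsDualSystem

variable {g : Gen Γ → E}

theorem exists_linearMap (hg : IsDualSystem ε g) : ∃ ρ : Module.Dual k (Gens k Γ) →ₗ[k] E,
    (∀ a, ρ (coord a) = g a) ∧ QuadAlg.dualRel (rel k Γ ε) ≤ LinearMap.ker (QuadAlg.mulMap ρ) := by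
  have hρ (a : Gen Γ) : (coordBasis k Γ).constr k g (coord a) = g a := by
    rw [← coordBasis_apply, Module.Basis.constr_basis]
  refine ⟨_, hρ, IsDualForm.dualRel_le_ker ?_⟩
  simpa only [QuadAlg.mulMap_tmul, hρ] using! hg

theorem exists_algHom (hg : IsDualSystem ε g) :
    ∃ φ : QuadAlg (QuadAlg.dualRel (rel k Γ ε)) →ₐ[k] E, ∀ a, φ (dualGen ε a) = g a := by
  obtain ⟨ρ, hρ, hker⟩ := hg.exists_linearMap
  exact ⟨QuadAlg.lift _ ρ hker, fun a => (QuadAlg.lift_gen _ ρ hker _).trans (hρ a)⟩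

end IsDualSystem

theorem range_gen_eq_span (ε : k) :
    LinearMap.range (QuadAlg.gen (QuadAlg.dualRel (rel k Γ ε))) =
      Submodule.span k (Set.range (dualGen ε)) := by
  rw [LinearMap.range_eq_map, ← (coordBasis k Γ).span_eq, Submodule.map_span, ← Set.range_comp]
  congr! 2
  ext a
  simp [dualGen, coordBasis_apply]

end DualSystem

theorem commute_mul_of_anticomm {R : Type*} [Ring R] {c x y : R} (hx : c * x = -(x * c))
    (hy : c * y = -(y * c)) : Commute c (x * y) := by
  rw [commute_iff_eq, ← mul_assoc, hx, neg_mul, mul_assoc, hy, mul_neg, neg_neg, mul_assoc]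

/-- The vector space with basis the finite subsets of `ι`. -/
def Fock (k ι : Type*) [Field k] : Type _ := Finset ι →₀ k

namespace Fock

variable {ι V : Type*}

noncomputable instance : AddCommGroup (Fock k ι) := inferInstanceAs (AddCommGroup (Finset ι →₀ k))

noncomputable instance : Module k (Fock k ι) := inferInstanceAs (Module k (Finset ι →₀ k))

variable (k ι) in
/-- The basis of the Fock space indexed by the finite sets. -/
noncomputable def ket : Module.Basis (Finset ι) k (Fock k ι) := ⟨LinearEquiv.refl k _⟩

open scoped Classical in
variable (k) in
/-- The sign of moving `a` to its place in the wedge product of the elements of `A`, taken in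
increasing order. -/
noncomputable def sign (a : ι) (A : Finset ι) : k := (-1) ^ (A.filter (WellOrderingRel · a)).card

theorem sign_mul_self (a : ι) (A : Finset ι) : sign k a A * sign k a A = 1 := by
  rw [sign, ← mul_pow, neg_mul_neg, one_mul, one_pow]

section Vacant

variable [DecidableEq V] {s : ι → Finset V} {S S' : Finset V}

theorem notMem_of_disjoint {a : ι} {A : Finset ι} (ha : (s a).Nonempty)
    (h : Disjoint (s a) (A.biUnion s)) : a ∉ A := fun h_mem =>
  ha.ne_empty (disjoint_self.mp ((Finset.disjoint_biUnion_right _ _ _).mp h a h_mem))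

variable (k s) in
/-- The projection to the span of the sets whose members have supports disjoint from `S`. -/
noncomputable def vacant (S : Finset V) : Module.End k (Fock k ι) :=
  (ket k ι).constr k fun A => if Disjoint S (A.biUnion s) then ket k ι A else 0

theorem vacant_ket (S : Finset V) (A : Finset ι) : vacant k s S (ket k ι A) =
    if Disjoint S (A.biUnion s) then ket k ι A else 0 := by
  rw [vacant, Module.Basis.constr_basis]

theorem vacant_empty : vacant k s ∅ = 1 :=
  (ket k ι).ext fun A => by simp [vacant_ket]

theorem vacant_mul_vacant : vacant k s S * vacant k s S' = vacant k s (S ∪ S') := by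
  refine (ket k ι).ext fun A => ?_
  simp only [Module.End.mul_apply, vacant_ket, Finset.disjoint_union_left]
  split_ifs <;> simp_all [vacant_ket]

end Vacant

variable [DecidableEq ι]

theorem sign_exchange {a b : ι} {A : Finset ι} (hab : a ≠ b) (ha : a ∉ A) (hb : b ∉ A) :
    sign k a (insert b A) * sign k b A = -(sign k b (insert a A) * sign k a A) := by
  classical
  have key {a b : ι} (h : WellOrderingRel a b) (ha : a ∉ A) :
      sign k a (insert b A) * sign k b A = -(sign k b (insert a A) * sign k a A) := by
    have hmem : a ∉ A.filter (WellOrderingRel · b) := fun h' => ha (Finset.mem_of_mem_filter a h')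
    rw [sign, sign, sign, sign, Finset.filter_insert, if_neg (asymm h), Finset.filter_insert,
      if_pos h, Finset.card_insert_of_notMem hmem]
    ring
  rcases trichotomous_of WellOrderingRel a b with h | h | h
  · exact key h ha
  · exact absurd h hab
  · rw [key h hb, neg_neg]

variable [DecidableEq V] (k) (s : ι → Finset V)

/-- The creation operator of `a`; it vanishes on the sets with a member whose support meets that
of `a`. -/
noncomputable def create (a : ι) : Module.End k (Fock k ι) :=
  (ket k ι).constr k fun A =>
    if Disjoint (s a) (A.biUnion s) then sign k a A • ket k ι (insert a A) else 0

/-- The annihilation operator of `a`. -/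
noncomputable def annihilate (a : ι) : Module.End k (Fock k ι) :=
  (ket k ι).constr k fun A =>
    if a ∈ A then sign k a (A.erase a) • ket k ι (A.erase a) else 0

variable {k s} {a b : ι} {A : Finset ι} {S S' : Finset V}

theorem create_ket (a : ι) (A : Finset ι) : create k s a (ket k ι A) =
    if Disjoint (s a) (A.biUnion s) then sign k a A • ket k ι (insert a A) else 0 := by
  rw [create, Module.Basis.constr_basis]

theorem annihilate_ket_of_notMem (ha : a ∉ A) : annihilate k a (ket k ι A) = 0 := by
  rw [annihilate, Module.Basis.constr_basis, if_neg ha]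

theorem annihilate_ket_insert (ha : a ∉ A) :
    annihilate k a (ket k ι (insert a A)) = sign k a A • ket k ι A := by
  rw [annihilate, Module.Basis.constr_basis, if_pos (Finset.mem_insert_self a A),
    Finset.erase_insert ha]

theorem vacant_mul_create_of_disjoint (h : Disjoint S (s a)) :
    vacant k s S * create k s a = create k s a * vacant k s S := by
  refine (ket k ι).ext fun A => ?_
  simp only [Module.End.mul_apply, vacant_ket, create_ket]
  split_ifs <;> simp_all [vacant_ket, create_ket]

theorem vacant_mul_create_of_not_disjoint (h : ¬ Disjoint S (s a)) :
    vacant k s S * create k s a = 0 := by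
  refine (ket k ι).ext fun A => ?_
  rw [Module.End.mul_apply, create_ket]
  split_ifs <;> simp [vacant_ket, h]

theorem create_mul_vacant_congr (h : S ∪ s a = S' ∪ s a) :
    create k s a * vacant k s S = create k s a * vacant k s S' := by
  refine (ket k ι).ext fun A => ?_
  have hiff (h' : Disjoint (s a) (A.biUnion s)) :
      Disjoint S (A.biUnion s) ↔ Disjoint S' (A.biUnion s) := by
    have := congrArg (Disjoint · (A.biUnion s)) h
    simpa [h', Finset.disjoint_union_left] using this
  simp only [Module.End.mul_apply, vacant_ket]
  split_ifs <;> simp_all [create_ket]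

theorem create_mul_create_of_not_disjoint (h : ¬ Disjoint (s a) (s b)) :
    create k s a * create k s b = 0 := by
  refine (ket k ι).ext fun A => ?_
  rw [Module.End.mul_apply, create_ket]
  split_ifs <;> simp [create_ket, h]

theorem create_mul_create_mul_vacant_congr (h : S ∪ (s a ∪ s b) = S' ∪ (s a ∪ s b)) :
    create k s a * create k s b * vacant k s S = create k s a * create k s b * vacant k s S' := by
  by_cases hab : Disjoint (s a) (s b)
  · have outer (S : Finset V) :
        create k s a * create k s b * vacant k s S = create k s a * vacant k s (S \ s b) *
          create k s b := by
      rw [mul_assoc, mul_assoc, vacant_mul_create_of_disjoint Finset.sdiff_disjoint,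
        create_mul_vacant_congr Finset.sdiff_union_self_eq_union.symm]
    rw [outer, outer, create_mul_vacant_congr]
    have h_sdiff := congrArg (· \ s b) h
    simpa [Finset.union_sdiff_distrib, hab.sdiff_eq_left] using h_sdiff
  · rw [create_mul_create_of_not_disjoint hab, zero_mul, zero_mul]

theorem vacant_mul_create_mul_create_of_disjoint (h : Disjoint S (s a ∪ s b)) :
    Commute (vacant k s S) (create k s a * create k s b) := by
  rw [Finset.disjoint_union_right] at h
  exact Commute.mul_right (vacant_mul_create_of_disjoint h.1) (vacant_mul_create_of_disjoint h.2)

theorem vacant_mul_create_mul_create_of_not_disjoint (h : ¬ Disjoint S (s a ∪ s b)) :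
    vacant k s S * (create k s a * create k s b) = 0 := by
  by_cases ha : Disjoint S (s a)
  · have hb : ¬ Disjoint S (s b) := fun hb => h (Finset.disjoint_union_right.mpr ⟨ha, hb⟩)
    rw [← mul_assoc, vacant_mul_create_of_disjoint ha, mul_assoc,
      vacant_mul_create_of_not_disjoint hb, mul_zero]
  · rw [← mul_assoc, vacant_mul_create_of_not_disjoint ha, zero_mul]

section NonemptySupports

variable (hs : ∀ a, (s a).Nonempty)

include hs

theorem annihilate_mul_create_self : annihilate k a * create k s a = vacant k s (s a) := by
  refine (ket k ι).ext fun A => ?_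
  rw [Module.End.mul_apply, create_ket, vacant_ket]
  split_ifs with h
  · rw [map_smul, annihilate_ket_insert (notMem_of_disjoint (hs a) h), smul_smul, sign_mul_self,
      one_smul]
  · exact map_zero _

theorem create_anticomm (a b : ι) :
    create k s a * create k s b = -(create k s b * create k s a) := by
  by_cases hab : Disjoint (s a) (s b)
  · refine (ket k ι).ext fun A => ?_
    have hne : a ≠ b := by
      rintro rfl
      exact (hs a).ne_empty (disjoint_self.mp hab)
    rw [LinearMap.neg_apply, Module.End.mul_apply, Module.End.mul_apply]
    by_cases ha : Disjoint (s a) (A.biUnion s) <;> by_cases hb : Disjoint (s b) (A.biUnion s)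
    · have hexch := sign_exchange (k := k) hne (notMem_of_disjoint (hs a) ha)
        (notMem_of_disjoint (hs b) hb)
      simp only [create_ket, ha, hb, hab, hab.symm, if_true, map_smul, smul_smul,
        Finset.biUnion_insert, Finset.disjoint_union_right, and_self, Finset.insert_comm a b]
      rw [mul_comm, hexch, neg_smul, mul_comm]
    all_goals simp [create_ket, ha, hb]
  · rw [create_mul_create_of_not_disjoint hab,
      create_mul_create_of_not_disjoint fun h => hab h.symm]
    exact (neg_zero (G := Module.End k (Fock k ι))).symm

theorem annihilate_mul_create_of_disjoint (hab : Disjoint (s a) (s b)) :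
    annihilate k a * create k s b = -(create k s b * annihilate k a) := by
  refine (ket k ι).ext fun A => ?_
  have hne : a ≠ b := by
    rintro rfl
    exact (hs a).ne_empty (disjoint_self.mp hab)
  rw [LinearMap.neg_apply, Module.End.mul_apply, Module.End.mul_apply]
  by_cases ha : a ∈ A
  · obtain ⟨C, haC, rfl⟩ : ∃ C, a ∉ C ∧ insert a C = A :=
      ⟨A.erase a, Finset.notMem_erase _ _, Finset.insert_erase ha⟩
    rw [annihilate_ket_insert haC, map_smul, create_ket, create_ket]
    have hiff : Disjoint (s b) ((insert a C).biUnion s) ↔ Disjoint (s b) (C.biUnion s) := by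
      rw [Finset.biUnion_insert, Finset.disjoint_union_right, and_iff_right hab.symm]
    by_cases hb : Disjoint (s b) (C.biUnion s)
    · have hbC := notMem_of_disjoint (hs b) hb
      have hexch := sign_exchange (k := k) hne haC hbC
      have hb_sq := sign_mul_self (k := k) b C
      have hba_sq := sign_mul_self (k := k) b (insert a C)
      rw [if_pos (hiff.mpr hb), if_pos hb, map_smul, Finset.insert_comm,
        annihilate_ket_insert (by simp [hne, haC]), smul_smul, smul_smul, ← neg_smul]
      congr 1
      linear_combination sign k b (insert a C) * sign k b C * hexch -
        sign k b (insert a C) * sign k a (insert b C) * hb_sq - sign k b C * sign k a C * hba_sq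
    · simp [hb]
  · rw [annihilate_ket_of_notMem ha, map_zero, neg_zero, create_ket]
    split_ifs
    · rw [map_smul, annihilate_ket_of_notMem (by simp [hne, ha]), smul_zero]
    · exact map_zero _

end NonemptySupports

theorem annihilate_mul_create_of_not_disjoint (hne : a ≠ b) (hab : ¬ Disjoint (s a) (s b)) :
    annihilate k a * create k s b = 0 := by
  refine (ket k ι).ext fun A => ?_
  rw [Module.End.mul_apply, create_ket]
  split_ifs with hb
  · have ha : a ∉ insert b A := fun h => hab
      (((Finset.disjoint_biUnion_right _ _ _).mp hb a (Finset.mem_of_mem_insert_of_ne h hne)).symm)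
    rw [map_smul, annihilate_ket_of_notMem ha, smul_zero, LinearMap.zero_apply]
  · exact map_zero _

end Fock

open Fock

variable {ε : k}

section Operators

variable {a b : Gen Γ} {S : Finset (Fin n)}

variable (k) in
/-- The sum of the creation operators of the two ends of an edge. -/
noncomputable def createEnds (e : Γ.edgeSet) : Module.End k (Fock k (Gen Γ)) :=
  ∑ v ∈ support (Sum.inr e : Gen Γ), create k support (Sum.inl v)

theorem createEnds_mk {i j : Fin n} (h : Γ.Adj i j) : createEnds k (⟨s(i, j), h⟩ : Γ.edgeSet) =
    create k support (Sum.inl i) + create k support (Sum.inl j) := by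
  rw [createEnds, support, Sym2.toFinset_mk_eq, Finset.sum_pair (Γ.ne_of_adj h)]

/-- The operators on the Fock space that satisfy all relations of the quadratic dual except for
those that come from the triangles. The correction for an edge `ij` acts only on the sets that cover
`i` or `j`, where the relation `u_{ij} b = ε u_i b` prescribes it. -/
noncomputable def op (ε : k) : Gen Γ → Module.End k (Fock k (Gen Γ))
  | Sum.inl i => create k support (Sum.inl i)
  | Sum.inr e => create k support (Sum.inr e) +
      ε • (createEnds k e * (1 - vacant k support (support (Sum.inr e : Gen Γ))))

theorem support_inr_subset_union {e : Γ.edgeSet} {v : Fin n}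
    (hv : v ∈ support (Sum.inr e : Gen Γ)) (hvS : v ∉ S)
    (hS : ¬ Disjoint S (support (Sum.inr e : Gen Γ))) :
    support (Sum.inr e : Gen Γ) ⊆ S ∪ support (Sum.inl v : Gen Γ) := by
  obtain ⟨w, hwS, hwe⟩ := Finset.not_disjoint_iff.mp hS
  rw [mem_support_inr] at hv hwe
  have hvw : v ≠ w := fun h => hvS (h ▸ hwS)
  intro x hx
  rw [mem_support_inr, (Sym2.mem_and_mem_iff hvw).mp ⟨hv, hwe⟩, Sym2.mem_iff] at hx
  rw [Finset.mem_union, mem_support_inl]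
  rcases hx with rfl | rfl
  · exact Or.inr rfl
  · exact Or.inl hwS

theorem create_mul_op_of_not_disjoint (h : ¬ Disjoint (support a) (support b)) :
    create k support a * op ε b = 0 := by
  rcases b with j | f
  · exact create_mul_create_of_not_disjoint h
  · rw [op, mul_add, create_mul_create_of_not_disjoint h, zero_add, mul_smul_comm, createEnds,
      Finset.sum_mul, Finset.mul_sum, Finset.sum_eq_zero, smul_zero]
    intro v hv
    by_cases hva : v ∈ support a
    · rw [← mul_assoc, create_mul_create_of_not_disjoint, zero_mul]
      exact Finset.not_disjoint_iff.mpr ⟨v, hva, mem_support_inl.mpr rfl⟩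
    · rw [← mul_assoc, mul_sub, create_mul_create_mul_vacant_congr (S' := ∅), vacant_empty,
        sub_self]
      rw [Finset.empty_union, Finset.union_eq_right]
      exact support_inr_subset_union hv hva h

theorem vacant_mul_op_of_not_disjoint (h : ¬ Disjoint S (support b)) :
    vacant k support S * op ε b = 0 := by
  rcases b with j | f
  · exact vacant_mul_create_of_not_disjoint h
  · rw [op, mul_add, vacant_mul_create_of_not_disjoint h, zero_add, mul_smul_comm, createEnds,
      Finset.sum_mul, Finset.mul_sum, Finset.sum_eq_zero, smul_zero]
    intro v hv
    by_cases hvS : v ∈ S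
    · rw [← mul_assoc, vacant_mul_create_of_not_disjoint, zero_mul]
      exact Finset.not_disjoint_iff.mpr ⟨v, hvS, mem_support_inl.mpr rfl⟩
    · have hdisj : Disjoint S (support (Sum.inl v : Gen Γ)) :=
        Finset.disjoint_singleton_right.mpr hvS
      rw [← mul_assoc, vacant_mul_create_of_disjoint hdisj, mul_assoc, mul_sub, mul_one,
        vacant_mul_vacant, mul_sub, create_mul_vacant_congr, sub_self]
      rw [Finset.union_right_comm, eq_comm, Finset.union_eq_left]
      exact support_inr_subset_union hv hvS h

theorem vacant_mul_op_of_disjoint (h : Disjoint S (support b)) :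
    vacant k support S * op ε b = op ε b * vacant k support S := by
  rcases b with j | f
  · exact vacant_mul_create_of_disjoint h
  · have h_ends : vacant k support S * createEnds k f = createEnds k f * vacant k support S := by
      rw [createEnds, Finset.mul_sum, Finset.sum_mul]
      refine Finset.sum_congr rfl fun v hv => vacant_mul_create_of_disjoint ?_
      exact h.mono_right (Finset.singleton_subset_iff.mpr hv)
    have h_vacant : Commute (vacant k (support (Γ := Γ)) S)
        (1 - vacant k support (support (Sum.inr f : Gen Γ))) :=
      (Commute.one_right _).sub_right (by
        rw [commute_iff_eq, vacant_mul_vacant, vacant_mul_vacant, Finset.union_comm])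
    rw [op, mul_add, add_mul, vacant_mul_create_of_disjoint h, mul_smul_comm, smul_mul_assoc,
      ← mul_assoc, h_ends, mul_assoc, mul_assoc, h_vacant.eq]

theorem create_mul_op_of_disjoint (h : Disjoint (support a) (support b)) :
    create k support a * op ε b = -(op ε b * create k support a) := by
  have hanti (x y : Gen Γ) := create_anticomm (k := k) (support_nonempty (Γ := Γ)) x y
  rcases b with j | f
  · exact hanti _ _
  · have h_ends : create k support a * createEnds k f =
        -(createEnds k f * create k support a) := by
      rw [createEnds, Finset.mul_sum, Finset.sum_mul, ← Finset.sum_neg_distrib]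
      exact Finset.sum_congr rfl fun v _ => hanti _ _
    have h_vacant : create k support a * (1 - vacant k support (support (Sum.inr f : Gen Γ))) =
        (1 - vacant k support (support (Sum.inr f : Gen Γ))) * create k support a := by
      rw [mul_sub, sub_mul, vacant_mul_create_of_disjoint h.symm, mul_one, one_mul]
    rw [op, mul_add, add_mul, hanti a, mul_smul_comm, smul_mul_assoc, ← mul_assoc, h_ends, neg_mul,
      mul_assoc, h_vacant, smul_neg, neg_add, mul_assoc]

theorem op_anticomm (h : Disjoint (support a) (support b)) :
    op ε a * op ε b = -(op ε b * op ε a) := by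
  rcases a with i | e
  · exact create_mul_op_of_disjoint h
  · have h_ends : createEnds k e * op ε b = -(op ε b * createEnds k e) := by
      rw [createEnds, Finset.mul_sum, Finset.sum_mul, ← Finset.sum_neg_distrib]
      refine Finset.sum_congr rfl fun v hv => create_mul_op_of_disjoint ?_
      exact h.mono_left (Finset.singleton_subset_iff.mpr hv)
    have h_vacant : (1 - vacant k support (support (Sum.inr e : Gen Γ))) * op ε b =
        op ε b * (1 - vacant k support (support (Sum.inr e : Gen Γ))) := by
      rw [mul_sub, sub_mul, vacant_mul_op_of_disjoint h, mul_one, one_mul]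
    rw [op, add_mul, mul_add, create_mul_op_of_disjoint h, mul_smul_comm, smul_mul_assoc,
      mul_assoc, h_vacant, ← mul_assoc, h_ends, neg_mul, smul_neg, neg_add, mul_assoc]

theorem op_inr_mul_op_of_not_disjoint {e : Γ.edgeSet}
    (h : ¬ Disjoint (support (Sum.inr e)) (support b)) :
    op ε (Sum.inr e) * op ε b = ε • (createEnds k e * op ε b) := by
  rw [op, add_mul, create_mul_op_of_not_disjoint h, zero_add, smul_mul_assoc, mul_assoc, sub_mul,
    one_mul, vacant_mul_op_of_not_disjoint h, sub_zero]

theorem op_inl_mul_op_of_mem {i : Fin n} (h : i ∈ support b) :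
    op ε (Sum.inl i) * op ε b = 0 :=
  create_mul_op_of_not_disjoint (Finset.not_disjoint_iff.mpr ⟨i, mem_support_inl.mpr rfl, h⟩)

theorem op_inr_mul_op_self (e : Γ.edgeSet) : op ε (Sum.inr e) * op ε (Sum.inr e) = 0 := by
  have hne := (support_nonempty (Sum.inr e : Gen Γ)).ne_empty
  rw [op_inr_mul_op_of_not_disjoint (mt disjoint_self.mp hne), createEnds, Finset.sum_mul]
  exact smul_eq_zero_of_right ε (Finset.sum_eq_zero fun v hv => op_inl_mul_op_of_mem hv)

theorem op_inr_mul_op {i j : Fin n} (h : Γ.Adj i j) (hj : j ∈ support b) :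
    op ε (Sum.inr ⟨s(i, j), h⟩) * op ε b = ε • (op ε (Sum.inl i) * op ε b) := by
  have hj_mem : j ∈ support (Sum.inr ⟨s(i, j), h⟩ : Gen Γ) :=
    mem_support_inr.mpr (Sym2.mem_mk_right i j)
  rw [op_inr_mul_op_of_not_disjoint (Finset.not_disjoint_iff.mpr ⟨j, hj_mem, hj⟩), createEnds_mk,
    add_mul]
  congr 1
  exact add_eq_left.mpr (op_inl_mul_op_of_mem hj)

end Operators

namespace Triangle

instance : Finite (Triangle Γ) := by
  refine Finite.of_injective (fun T : Triangle Γ => (T.a, T.b, T.c)) ?_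
  rintro ⟨a, b, c, _, _, _, _, _⟩ ⟨a', b', c', _, _, _, _, _⟩ h
  simp only [Prod.mk.injEq] at h
  obtain ⟨rfl, rfl, rfl⟩ := h
  rfl

/-- The set of vertices of a triangle. -/
def vertices (T : Triangle Γ) : Finset (Fin n) := {T.a, T.b, T.c}

theorem isNClique (T : Triangle Γ) : Γ.IsNClique 3 T.vertices :=
  SimpleGraph.is3Clique_triple_iff.mpr ⟨T.adj_ab, T.adj_ac, T.adj_bc⟩

theorem vertices_injective : Function.Injective (vertices : Triangle Γ → Finset (Fin n)) := by
  rintro ⟨a, b, c, hab, hbc, _, _, _⟩ ⟨a', b', c', hab', hbc', _, _, _⟩ h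
  simp only [vertices, Finset.ext_iff, Finset.mem_insert, Finset.mem_singleton] at h
  have ha := (h a).mp (by simp)
  have hb := (h b).mp (by simp)
  have hc := (h c).mp (by simp)
  have ha' := (h a').mpr (by simp)
  simp only [Triangle.mk.injEq]
  omega

theorem disjoint_vertices (hΓ : NoOverlappingTriangles Γ) {T U : Triangle Γ} (h : T ≠ U) :
    Disjoint T.vertices U.vertices :=
  hΓ _ _ T.isNClique U.isNClique (vertices_injective.ne h)

variable (T : Triangle Γ)

theorem support_ab : support (Sum.inr T.ab : Gen Γ) = {T.a, T.b} := Sym2.toFinset_mk_eq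

theorem support_bc : support (Sum.inr T.bc : Gen Γ) = {T.b, T.c} := Sym2.toFinset_mk_eq

theorem support_ac : support (Sum.inr T.ac : Gen Γ) = {T.a, T.c} := Sym2.toFinset_mk_eq

variable (k) in
/-- The triangle relation evaluated at the creation operators. -/
noncomputable def defect : Module.End k (Fock k (Gen Γ)) :=
  create k support (Sum.inl T.a) * create k support (Sum.inr T.bc) +
  create k support (Sum.inl T.b) * create k support (Sum.inr T.ac) +
  create k support (Sum.inl T.c) * create k support (Sum.inr T.ab)

variable (k) in
/-- The operator that annihilates the leading term of the triangle relation. -/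
noncomputable def annihilateLeading : Module.End k (Fock k (Gen Γ)) :=
  annihilate k (Sum.inr T.ab) * annihilate k (Sum.inl T.c)

theorem support_union_bc :
    support (Sum.inl T.a : Gen Γ) ∪ support (Sum.inr T.bc : Gen Γ) = T.vertices := by
  rw [support_bc]
  rfl

theorem support_union_ac :
    support (Sum.inl T.b : Gen Γ) ∪ support (Sum.inr T.ac : Gen Γ) = T.vertices := by
  rw [support_ac]
  exact Finset.insert_comm T.b T.a {T.c}

theorem support_union_ab :
    support (Sum.inl T.c : Gen Γ) ∪ support (Sum.inr T.ab : Gen Γ) = T.vertices := by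
  rw [support_ab, Finset.union_comm]
  exact Finset.insert_union _ _ _

theorem commute_create_defect (x : Gen Γ) : Commute (create k support x) (T.defect k) := by
  have hanti (y : Gen Γ) := create_anticomm (k := k) support_nonempty x y
  have hcomm (y z : Gen Γ) := commute_mul_of_anticomm (hanti y) (hanti z)
  exact ((hcomm _ _).add_right (hcomm _ _)).add_right (hcomm _ _)

variable {T}

theorem commute_vacant_defect {S : Finset (Fin n)} (h : Disjoint S T.vertices) :
    Commute (vacant k support S) (T.defect k) := by
  refine ((vacant_mul_create_mul_create_of_disjoint ?_).add_right
    (vacant_mul_create_mul_create_of_disjoint ?_)).add_right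
    (vacant_mul_create_mul_create_of_disjoint ?_)
  · rwa [support_union_bc]
  · rwa [support_union_ac]
  · rwa [support_union_ab]

theorem vacant_mul_defect_eq_zero {S : Finset (Fin n)} (h : ¬ Disjoint S T.vertices) :
    vacant k support S * T.defect k = 0 := by
  rw [defect, mul_add, mul_add, vacant_mul_create_mul_create_of_not_disjoint,
    vacant_mul_create_mul_create_of_not_disjoint, vacant_mul_create_mul_create_of_not_disjoint,
    add_zero, add_zero]
  · rwa [support_union_ab]
  · rwa [support_union_ac]
  · rwa [support_union_bc]

variable (T)

theorem defect_mul_vacant : T.defect k * vacant k support T.vertices = T.defect k := by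
  have hterm {x y : Gen Γ} (h : support x ∪ support y = T.vertices) :
      create k support x * create k support y * vacant k support T.vertices =
        create k support x * create k support y := by
    rw [create_mul_create_mul_vacant_congr (S' := ∅), vacant_empty, mul_one]
    rw [h, Finset.union_self, Finset.empty_union]
  rw [defect, add_mul, add_mul, hterm T.support_union_bc, hterm T.support_union_ac,
    hterm T.support_union_ab]

theorem annihilateLeading_mul_defect :
    T.annihilateLeading k * T.defect k = vacant k support T.vertices := by
  have hdisj : Disjoint (support (Sum.inl T.c : Gen Γ)) (support (Sum.inr T.ab)) := by
    rw [support_ab]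
    simp [support, T.b_lt_c.ne', (T.a_lt_b.trans T.b_lt_c).ne']
  have hzero {v : Fin n} {e : Γ.edgeSet} (hv : v ≠ T.c) (he : T.c ∈ e.1) :
      annihilate k (Sum.inl T.c) *
        (create k support (Sum.inl v) * create k support (Sum.inr e)) = 0 := by
    have hcv : Disjoint (support (Sum.inl T.c : Gen Γ)) (support (Sum.inl v : Gen Γ)) :=
      Finset.disjoint_singleton.mpr hv.symm
    rw [← mul_assoc, annihilate_mul_create_of_disjoint support_nonempty hcv, neg_mul, mul_assoc,
      annihilate_mul_create_of_not_disjoint Sum.inl_ne_inr, mul_zero, neg_zero]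
    exact Finset.not_disjoint_iff.mpr ⟨T.c, mem_support_inl.mpr rfl, mem_support_inr.mpr he⟩
  have hleading : annihilate k (Sum.inl T.c) *
      (create k support (Sum.inl T.c) * create k support (Sum.inr T.ab)) =
      create k support (Sum.inr T.ab) * vacant k support (support (Sum.inl T.c : Gen Γ)) := by
    rw [← mul_assoc, annihilate_mul_create_self support_nonempty,
      vacant_mul_create_of_disjoint hdisj]
  rw [annihilateLeading, mul_assoc, defect, mul_add, mul_add, mul_add, hleading,
    hzero (T.a_lt_b.trans T.b_lt_c).ne (Sym2.mem_mk_right _ _),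
    hzero T.b_lt_c.ne (Sym2.mem_mk_right _ _), add_zero, mul_zero, zero_add, ← mul_assoc,
    annihilate_mul_create_self support_nonempty, vacant_mul_vacant, Finset.union_comm,
    support_union_ab]

theorem defect_mul_annihilateLeading_mul_defect :
    T.defect k * T.annihilateLeading k * T.defect k = T.defect k := by
  rw [mul_assoc, annihilateLeading_mul_defect, defect_mul_vacant]

theorem commute_defect (U : Triangle Γ) : Commute (T.defect k) (U.defect k) := by
  have h (x : Gen Γ) := U.commute_create_defect (k := k) x
  exact (((h _).mul_left (h _)).add_left ((h _).mul_left (h _))).add_left ((h _).mul_left (h _))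

variable {T}

theorem commute_annihilateLeading_defect {U : Triangle Γ} (h : Disjoint T.vertices U.vertices) :
    Commute (T.annihilateLeading k) (U.defect k) := by
  have hcomm {x y z : Gen Γ} (hx : support x ⊆ T.vertices)
      (hyz : support y ∪ support z = U.vertices) :
      Commute (annihilate k x) (create k support y * create k support z) := by
    have hdisj : Disjoint (support x) (support y ∪ support z) := hyz ▸ h.mono_left hx
    rw [Finset.disjoint_union_right] at hdisj
    exact commute_mul_of_anticomm (annihilate_mul_create_of_disjoint support_nonempty hdisj.1)
      (annihilate_mul_create_of_disjoint support_nonempty hdisj.2)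
  have hx {x : Gen Γ} (hx : support x ⊆ T.vertices) : Commute (annihilate k x) (U.defect k) :=
    ((hcomm hx U.support_union_bc).add_right (hcomm hx U.support_union_ac)).add_right
      (hcomm hx U.support_union_ab)
  refine (hx ?_).mul_left (hx ?_) <;> rw [← T.support_union_ab]
  · exact Finset.subset_union_right
  · exact Finset.subset_union_left

end Triangle

theorem create_mul_create_mul_one_sub_vacant (x y z : Fin n) :
    create k support (Sum.inl x : Gen Γ) * create k support (Sum.inl y) *
        (1 - vacant k support {y, z}) =
      -(create k support (Sum.inl y) * create k support (Sum.inl x) *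
        (1 - vacant k support {x, z})) := by
  have hset : {y, z} ∪ (support (Sum.inl x : Gen Γ) ∪ support (Sum.inl y : Gen Γ)) =
      {x, z} ∪ (support (Sum.inl x : Gen Γ) ∪ support (Sum.inl y : Gen Γ)) := by
    ext v
    simp only [Finset.mem_union, Finset.mem_insert, Finset.mem_singleton, mem_support_inl]
    tauto
  rw [mul_sub, create_mul_create_mul_vacant_congr hset, ← mul_sub,
    create_anticomm support_nonempty, neg_mul]

theorem op_inl_mul_op_inr (x : Fin n) {y z : Fin n} (h : Γ.Adj y z) :
    op ε (Sum.inl x) * op ε (Sum.inr ⟨s(y, z), h⟩) =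
      create k support (Sum.inl x) * create k support (Sum.inr ⟨s(y, z), h⟩) +
      ε • (create k support (Sum.inl x) * create k support (Sum.inl y) *
          (1 - vacant k support {y, z}) +
        create k support (Sum.inl x) * create k support (Sum.inl z) *
          (1 - vacant k support {z, y})) := by
  rw [op, op, createEnds_mk, mul_add, mul_smul_comm, ← mul_assoc, mul_add, add_mul, support,
    Sym2.toFinset_mk_eq, Finset.pair_comm z y]

namespace Triangle

theorem op_add_op_add_op (T : Triangle Γ) :
    op ε (Sum.inl T.a) * op ε (Sum.inr T.bc) + op ε (Sum.inl T.b) * op ε (Sum.inr T.ac) +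
      op ε (Sum.inl T.c) * op ε (Sum.inr T.ab) = T.defect k := by
  rw [ab, bc, ac, op_inl_mul_op_inr, op_inl_mul_op_inr, op_inl_mul_op_inr,
    create_mul_create_mul_one_sub_vacant T.a T.b, create_mul_create_mul_one_sub_vacant T.a T.c,
    create_mul_create_mul_one_sub_vacant T.b T.c, defect, ab, bc, ac]
  module

end Triangle

/-- The product of a list of elements of a family. -/
def monomial {ι R : Type*} [Monoid R] (g : ι → R) (l : List ι) : R := (l.map g).prod

theorem monomial_cons {ι R : Type*} [Monoid R] (g : ι → R) (a : ι) (l : List ι) :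
    monomial g (a :: l) = g a * monomial g l := by
  rw [monomial, List.map_cons, List.prod_cons, monomial]

theorem exists_mul_eq_zero_of_commute {R M τ : Type*} [Ring R] [AddCommGroup M] [Module R M]
    {D α : τ → R} (hD : ∀ t u, Commute (D t) (D u)) (hα : ∀ t, D t * α t * D t = D t)
    (hαD : ∀ t u, t ≠ u → Commute (α t) (D u)) (s : Finset τ) :
    ∃ π : R, (∀ t ∈ s, π * D t = 0) ∧ (∀ x, (∀ t ∈ s, x * D t = 0) → x * π = x) ∧
      ∀ v : M, (∀ t ∈ s, α t • v = 0) → π • v = v := by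
  classical
  induction s using Finset.induction_on with
  | empty => exact ⟨1, by simp⟩
  | insert u s hu ih =>
    obtain ⟨π, hπD, hπ, hπv⟩ := ih
    simp only [Finset.forall_mem_insert]
    refine ⟨π * (1 - D u * α u), ⟨?_, fun t ht => ?_⟩, fun x ⟨hxu, hx⟩ => ?_,
      fun v ⟨hvu, hv⟩ => ?_⟩
    · rw [mul_assoc, sub_mul, one_mul, hα, sub_self, mul_zero]
    · have hcomm : Commute (1 - D u * α u) (D t) :=
        (Commute.one_left _).sub_left
          ((hD u t).mul_left (hαD u t (ne_of_mem_of_not_mem ht hu).symm))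
      rw [mul_assoc, hcomm.eq, ← mul_assoc, hπD t ht, zero_mul]
    · rw [← mul_assoc, hπ x hx, mul_sub, ← mul_assoc, hxu, zero_mul, mul_one, sub_zero]
    · rw [mul_smul, sub_smul, mul_smul, hvu, smul_zero, one_smul, sub_zero, hπv v hv]

/-- The sets of generators that index the basis of reduced monomials: the leading term
`u_c u_{ab}` of every triangle relation, with `a < b < c`, is forbidden. -/
def IsReduced (A : Finset (Gen Γ)) : Prop :=
  (A : Set (Gen Γ)).PairwiseDisjoint support ∧
    ∀ i e, Sum.inl i ∈ A → Sum.inr e ∈ A → ¬ Caps i e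

namespace Triangle

theorem exists_op_mul_defect (a : Gen Γ) (T : Triangle Γ) :
    ∃ f, op ε a * T.defect k = T.defect k * f := by
  rcases a with i | e
  · exact ⟨_, (T.commute_create_defect _).eq⟩
  have h_create := T.commute_create_defect (k := k) (Sum.inr e)
  have h_ends : Commute (createEnds k e) (T.defect k) :=
    Commute.sum_left _ _ _ fun v _ => T.commute_create_defect _
  by_cases h : Disjoint (support (Sum.inr e : Gen Γ)) T.vertices
  · have h_vacant := (Commute.one_left (T.defect k)).sub_left (commute_vacant_defect h)
    exact ⟨_, (h_create.add_left ((h_ends.mul_left h_vacant).smul_left ε)).eq⟩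
  · refine ⟨create k support (Sum.inr e) + ε • createEnds k e, ?_⟩
    rw [op, add_mul, smul_mul_assoc, mul_assoc, sub_mul, one_mul, vacant_mul_defect_eq_zero h,
      sub_zero, h_create.eq, h_ends.eq, mul_add, mul_smul_comm]

theorem annihilateLeading_ket (T : Triangle Γ) {A : Finset (Gen Γ)} (hA : IsReduced A) :
    T.annihilateLeading k (ket k _ A) = 0 := by
  rw [annihilateLeading, Module.End.mul_apply]
  by_cases hc : Sum.inl T.c ∈ A
  · have hab : Sum.inr T.ab ∉ A := fun hab => hA.2 _ _ hc hab T.caps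
    obtain ⟨C, hcC, rfl⟩ : ∃ C, Sum.inl T.c ∉ C ∧ insert (Sum.inl T.c) C = A :=
      ⟨A.erase _, Finset.notMem_erase _ _, Finset.insert_erase hc⟩
    rw [annihilate_ket_insert hcC, map_smul,
      annihilate_ket_of_notMem fun h => hab (Finset.mem_insert_of_mem h), smul_zero]
  · rw [annihilate_ket_of_notMem hc, map_zero]

end Triangle

theorem exists_isDualSystem_mul_op (hΓ : NoOverlappingTriangles Γ) (ε : k) :
    ∃ π : Module.End k (Fock k (Gen Γ)), IsDualSystem ε (fun a => π * op ε a) ∧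
      (∀ a, π * op ε a * π = π * op ε a) ∧ ∀ A, IsReduced A → π (ket k _ A) = ket k _ A := by
  classical
  have := Fintype.ofFinite (Triangle Γ)
  obtain ⟨π, hπD, hπ, hπv⟩ := exists_mul_eq_zero_of_commute (M := Fock k (Gen Γ))
    (fun T U : Triangle Γ => T.commute_defect (k := k) U)
    (fun T => T.defect_mul_annihilateLeading_mul_defect)
    (fun T U h => Triangle.commute_annihilateLeading_defect (Triangle.disjoint_vertices hΓ h))
    Finset.univ
  have hop (a : Gen Γ) : π * op ε a * π = π * op ε a := hπ _ fun T _ => by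
    obtain ⟨f, hf⟩ := T.exists_op_mul_defect (ε := ε) a
    rw [mul_assoc, hf, ← mul_assoc, hπD T (Finset.mem_univ T), zero_mul]
  have hmul (a b : Gen Γ) : π * op ε a * (π * op ε b) = π * (op ε a * op ε b) := by
    rw [← mul_assoc, hop, mul_assoc]
  refine ⟨π, ?_, hop, fun A hA => hπv _ fun T _ => T.annihilateLeading_ket hA⟩
  rw [IsDualSystem]
  simp only [hmul]
  exact
    { anticomm a b h := by rw [op_anticomm h, mul_neg]
      vertex i b h := by rw [op_inl_mul_op_of_mem h, mul_zero]
      edge i j h b _ hj := by rw [op_inr_mul_op h hj, mul_smul_comm]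
      edge_self e := by rw [op_inr_mul_op_self, mul_zero]
      triangle T := by
        rw [← mul_add, ← mul_add, T.op_add_op_add_op, hπD T (Finset.mem_univ T)] }

theorem op_ket_of_disjoint {b : Gen Γ} {A : Finset (Gen Γ)}
    (h : Disjoint (support b) (A.biUnion support)) :
    op ε b (ket k _ A) = sign k b A • ket k _ (insert b A) := by
  have h_create : create k support b (ket k _ A) = sign k b A • ket k _ (insert b A) := by
    rw [create_ket, if_pos h]
  rcases b with j | f
  · exact h_create
  · rw [op, LinearMap.add_apply, h_create, LinearMap.smul_apply, Module.End.mul_apply,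
      LinearMap.sub_apply, Module.End.one_apply, vacant_ket, if_pos h, sub_self, map_zero,
      smul_zero, add_zero]

/-- The supports of the generators in the list are pairwise disjoint. -/
def IsDisjointList (l : List (Gen Γ)) : Prop :=
  l.Pairwise fun a b => Disjoint (support a) (support b)

theorem exists_monomial_ket_empty {π : Module.End k (Fock k (Gen Γ))}
    (hπ : ∀ a, π * op ε a * π = π * op ε a) (hπ_empty : π (ket k _ ∅) = ket k _ ∅)
    {l : List (Gen Γ)} (hl : IsDisjointList l) :
    ∃ t : kˣ, monomial (fun a => π * op ε a) l (ket k _ ∅) = t • π (ket k _ l.toFinset) := by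
  induction l with
  | nil => exact ⟨1, by simp [monomial, hπ_empty]⟩
  | cons a l ih =>
    obtain ⟨ha, hl⟩ := List.pairwise_cons.mp hl
    obtain ⟨t, ht⟩ := ih hl
    have h_disj : Disjoint (support a) (l.toFinset.biUnion support) :=
      (Finset.disjoint_biUnion_right _ _ _).mpr fun b hb => ha b (List.mem_toFinset.mp hb)
    refine ⟨t * ⟨_, _, sign_mul_self a l.toFinset, sign_mul_self a l.toFinset⟩, ?_⟩
    calc monomial (fun a => π * op ε a) (a :: l) (ket k _ ∅)
        = (π * op ε a) (monomial (fun a => π * op ε a) l (ket k _ ∅)) := by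
          rw [monomial_cons, Module.End.mul_apply]
      _ = t • (π * op ε a * π) (ket k _ l.toFinset) := by
          rw [ht, Units.smul_def, map_smul, Module.End.mul_apply (π * op ε a), Units.smul_def]
      _ = _ := by
          rw [hπ, Module.End.mul_apply, op_ket_of_disjoint h_disj, map_smul, List.toFinset_cons,
            mul_smul]
          rfl

theorem IsReduced.isDisjointList_toList {A : Finset (Gen Γ)} (hA : IsReduced A) :
    IsDisjointList A.toList :=
  A.nodup_toList.pairwise_of_forall_ne fun _ ha _ hb h =>
    hA.1 (Finset.mem_toList.mp ha) (Finset.mem_toList.mp hb) h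

theorem isReduced_empty : IsReduced (∅ : Finset (Gen Γ)) := by
  simp [IsReduced]

theorem linearIndependent_monomial (hΓ : NoOverlappingTriangles Γ) (ε : k) :
    LinearIndependent k fun A : {A : Finset (Gen Γ) // IsReduced A} =>
      monomial (dualGen ε) A.1.toList := by
  obtain ⟨π, hsys, hπ, hπ_ket⟩ := exists_isDualSystem_mul_op hΓ ε
  obtain ⟨φ, hφ⟩ := hsys.exists_algHom
  choose t ht using fun A : {A : Finset (Gen Γ) // IsReduced A} =>
    exists_monomial_ket_empty hπ (hπ_ket ∅ isReduced_empty) A.2.isDisjointList_toList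
  have hvac (A : {A : Finset (Gen Γ) // IsReduced A}) :
      φ (monomial (dualGen ε) A.1.toList) (ket k _ ∅) = t A • ket k _ A.1 := by
    rw [monomial, map_list_prod, List.map_map, ← hπ_ket A.1 A.2, ← A.1.toList_toFinset]
    simpa [monomial, Function.comp_def, hφ] using ht A
  refine LinearIndependent.of_comp
    (LinearMap.applyₗ (ket k _ ∅) ∘ₗ φ.toLinearMap : _ →ₗ[k] Fock k (Gen Γ)) ?_
  convert ((ket k (Gen Γ)).linearIndependent.comp _ Subtype.val_injective).units_smul t using 1
  exact funext hvac

section Spanning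

variable {E : Type*} [Ring E] [Algebra k E] {g : Gen Γ → E} {l l' : List (Gen Γ)}

theorem exists_perm_cons_of_mem {α : Type*} {a : α} {l : List α} (h : a ∈ l) :
    ∃ l', l.Perm (a :: l') := by
  obtain ⟨s, t, rfl⟩ := List.append_of_mem h
  exact ⟨s ++ t, List.perm_middle⟩

namespace IsDisjointList

theorem nodup (hl : IsDisjointList l) : l.Nodup := by
  refine List.Pairwise.imp ?_ hl
  rintro a _ h rfl
  exact (support_nonempty a).ne_empty (disjoint_self.mp h)

theorem perm (hl : IsDisjointList l) (h : l.Perm l') : IsDisjointList l' :=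
  h.pairwise hl fun h => h.symm

theorem replace {a b a' b' : Gen Γ} (hl : IsDisjointList (a :: b :: l))
    (h : Disjoint (support a') (support b')) (ha : support a' ⊆ support a ∪ support b)
    (hb : support b' ⊆ support a ∪ support b) : IsDisjointList (a' :: b' :: l) := by
  obtain ⟨⟨-, ha_l⟩, hb_l, hl⟩ := by
    simpa only [IsDisjointList, List.pairwise_cons, List.forall_mem_cons] using hl
  have hab_l (c) (hc : c ∈ l) : Disjoint (support a ∪ support b) (support c) :=
    Finset.disjoint_union_left.mpr ⟨ha_l c hc, hb_l c hc⟩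
  simp only [IsDisjointList, List.pairwise_cons, List.forall_mem_cons]
  exact ⟨⟨h, fun c hc => (hab_l c hc).mono_left ha⟩, fun c hc => (hab_l c hc).mono_left hb, hl⟩

theorem exists_triangle (hl : IsDisjointList l) (h : ¬ IsReduced l.toFinset) :
    ∃ (T : Triangle Γ) (l' : List (Gen Γ)), l.Perm (Sum.inl T.c :: Sum.inr T.ab :: l') := by
  have h_disj : (l.toFinset : Set (Gen Γ)).PairwiseDisjoint support :=
    (List.pairwiseDisjoint_iff_coe_toFinset_pairwise_disjoint hl.nodup).mpr hl
  obtain ⟨i, e, hi, he, hie⟩ : ∃ i e, Sum.inl i ∈ l ∧ Sum.inr e ∈ l ∧ Caps i e := by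
    by_contra! h_caps
    exact h ⟨h_disj, by simpa only [List.mem_toFinset] using h_caps⟩
  obtain ⟨T, rfl, rfl⟩ := hie.exists_triangle
  obtain ⟨l₁, h_perm₁⟩ := exists_perm_cons_of_mem hi
  have he₁ : Sum.inr T.ab ∈ l₁ := by simpa using h_perm₁.subset he
  obtain ⟨l₂, h_perm₂⟩ := exists_perm_cons_of_mem he₁
  exact ⟨T, l₂, h_perm₁.trans (h_perm₂.cons _)⟩

theorem of_triangle {T : Triangle Γ} (hl : IsDisjointList (Sum.inl T.c :: Sum.inr T.ab :: l)) :
    IsDisjointList (Sum.inl T.a :: Sum.inr T.bc :: l) ∧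
      IsDisjointList (Sum.inl T.b :: Sum.inr T.ac :: l) := by
  have hab := T.a_lt_b
  have hbc := T.b_lt_c
  constructor <;> refine hl.replace (Finset.disjoint_left.mpr fun v => ?_) (fun v => ?_) fun v => ?_
  all_goals
    simp only [mem_support_inl, mem_support_inr, Triangle.ab, Triangle.bc, Triangle.ac,
      Sym2.mem_iff, Finset.mem_union]
    grind

end IsDisjointList

namespace IsDualSystem

theorem exists_monomial_eq_smul (hg : IsDualSystem ε g) (hl : IsDisjointList l)
    (h : l.Perm l') : ∃ t : k, monomial g l = t • monomial g l' := by
  induction h with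
  | nil => exact ⟨1, (one_smul _ _).symm⟩
  | cons a _ ih =>
    obtain ⟨t, ht⟩ := ih (List.pairwise_cons.mp hl).2
    exact ⟨t, by rw [monomial_cons, monomial_cons, ht, mul_smul_comm]⟩
  | swap a b l =>
    have hba : g b * g a = -(g a * g b) :=
      hg.anticomm b a ((List.pairwise_cons.mp hl).1 a List.mem_cons_self)
    exact ⟨-1, by simp only [monomial_cons, ← mul_assoc, hba, neg_mul, neg_smul, one_smul]⟩
  | trans h₁ _ ih₁ ih₂ =>
    obtain ⟨t₁, ht₁⟩ := ih₁ hl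
    obtain ⟨t₂, ht₂⟩ := ih₂ (hl.perm h₁)
    exact ⟨t₁ * t₂, by rw [ht₁, ht₂, smul_smul]⟩

theorem monomial_triangle (hg : IsDualSystem ε g) (T : Triangle Γ) (l : List (Gen Γ)) :
    monomial g (Sum.inl T.c :: Sum.inr T.ab :: l) =
      -(monomial g (Sum.inl T.a :: Sum.inr T.bc :: l) +
        monomial g (Sum.inl T.b :: Sum.inr T.ac :: l)) := by
  simp only [monomial_cons, ← mul_assoc, ← add_mul, ← neg_mul]
  rw [eq_neg_of_add_eq_zero_right (hg.triangle T)]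

theorem exists_mul_eq_smul_mul (hg : IsDualSystem ε g) {e : Γ.edgeSet} {b : Gen Γ}
    (h : ¬ Disjoint (support (Sum.inr e)) (support b)) :
    ∃ i, g (Sum.inr e) * g b = ε • (g (Sum.inl i) * g b) := by
  by_cases hb : b = Sum.inr e
  · obtain ⟨i, hi⟩ := support_nonempty b
    subst hb
    exact ⟨i, by rw [hg.edge_self e, hg.vertex i _ hi, smul_zero]⟩
  · obtain ⟨i, j, hij, rfl, hi, hj⟩ := exists_eq_mk_of_not_disjoint hb h
    exact ⟨i, hg.edge i j hij b hi hj⟩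

end IsDualSystem

variable (k) in
theorem monomial_mem_span_range_pow (g : Gen Γ → E) (l : List (Gen Γ)) :
    monomial g l ∈ Submodule.span k (Set.range g) ^ l.length := by
  induction l with
  | nil => exact Submodule.one_le.mp le_rfl
  | cons a l ih =>
    rw [monomial_cons, List.length_cons, pow_succ']
    exact Submodule.mul_mem_mul (Submodule.subset_span ⟨a, rfl⟩) ih

variable (k) in
/-- The span of the reduced monomials of degree `d`. -/
def reducedSpan (g : Gen Γ → E) (d : ℕ) : Submodule k E :=
  Submodule.span k (Set.range fun A : {A : Finset (Gen Γ) // IsReduced A ∧ A.card = d} =>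
    monomial g A.1.toList)

/-- The sum of the vertices in a list of generators, not counting the edges. The triangle relation
rewrites the leading monomial into monomials of smaller weight. -/
def vertexWeight (l : List (Gen Γ)) : ℕ :=
  (l.map (Sum.elim (fun i : Fin n => (i : ℕ)) fun _ => 0)).sum

theorem vertexWeight_inl_inr (i : Fin n) (e : Γ.edgeSet) (l : List (Gen Γ)) :
    vertexWeight (Sum.inl i :: Sum.inr e :: l) = i + vertexWeight l := by
  simp [vertexWeight]

namespace IsDualSystem

theorem monomial_mem_of_perm (hg : IsDualSystem ε g) (hl : IsDisjointList l) (h : l.Perm l')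
    {S : Submodule k E} (hS : monomial g l' ∈ S) : monomial g l ∈ S := by
  obtain ⟨t, ht⟩ := hg.exists_monomial_eq_smul hl h
  exact ht ▸ S.smul_mem t hS

theorem monomial_mem_reducedSpan (hg : IsDualSystem ε g) (hl : IsDisjointList l) :
    monomial g l ∈ reducedSpan k g l.length := by
  induction hw : vertexWeight l using Nat.strong_induction_on generalizing l with
  | _ w ih =>
  by_cases hred : IsReduced l.toFinset
  · refine hg.monomial_mem_of_perm hl (List.toFinset_toList hl.nodup).symm ?_
    exact Submodule.subset_span ⟨⟨_, hred, List.toFinset_card_of_nodup hl.nodup⟩, rfl⟩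
  obtain ⟨T, l', h_perm⟩ := hl.exists_triangle hred
  have hl' := hl.perm h_perm
  have h_weight : w = T.c + vertexWeight l' := by
    rw [← hw, ← vertexWeight_inl_inr T.c T.ab]
    exact (h_perm.map _).sum_eq
  have h_smaller (i : Fin n) (e : Γ.edgeSet) (hi : i < T.c)
      (h : IsDisjointList (Sum.inl i :: Sum.inr e :: l')) :
      monomial g (Sum.inl i :: Sum.inr e :: l') ∈ reducedSpan k g l.length := by
    rw [h_perm.length_eq]
    exact ih _ (by rw [vertexWeight_inl_inr, h_weight]; simpa using hi) h rfl
  obtain ⟨h_bc, h_ac⟩ := hl'.of_triangle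
  refine hg.monomial_mem_of_perm hl h_perm ?_
  rw [hg.monomial_triangle]
  exact neg_mem <|
    add_mem (h_smaller _ _ (T.a_lt_b.trans T.b_lt_c) h_bc) (h_smaller _ _ T.b_lt_c h_ac)

theorem exists_mul_monomial_eq (hg : IsDualSystem ε g) (hl : IsDisjointList l) {b : Gen Γ}
    (hb : b ∈ l) : ∃ y, ∀ x, x * monomial g l = x * g b * y := by
  obtain ⟨l', h_perm⟩ := exists_perm_cons_of_mem hb
  obtain ⟨t, ht⟩ := hg.exists_monomial_eq_smul hl h_perm
  refine ⟨t • monomial g l', fun x => ?_⟩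
  rw [ht, monomial_cons, mul_smul_comm, mul_smul_comm, mul_assoc]

theorem mul_monomial_mem_reducedSpan_of_disjoint (hg : IsDualSystem ε g) (hl : IsDisjointList l)
    {a : Gen Γ} (h : ∀ b ∈ l, Disjoint (support a) (support b)) :
    g a * monomial g l ∈ reducedSpan k g (l.length + 1) := by
  have h_cons : IsDisjointList (a :: l) := List.pairwise_cons.mpr ⟨h, hl⟩
  simpa only [monomial_cons, List.length_cons] using hg.monomial_mem_reducedSpan h_cons

theorem vertex_mul_monomial_mem_reducedSpan (hg : IsDualSystem ε g) (i : Fin n)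
    (hl : IsDisjointList l) :
    g (Sum.inl i) * monomial g l ∈ reducedSpan k g (l.length + 1) := by
  by_cases! h : ∀ b ∈ l, Disjoint (support (Sum.inl i : Gen Γ)) (support b)
  · exact hg.mul_monomial_mem_reducedSpan_of_disjoint hl h
  obtain ⟨b, hb, hib⟩ := h
  obtain ⟨y, hy⟩ := hg.exists_mul_monomial_eq hl hb
  have hib : i ∈ support b := by simpa [support] using hib
  have h_zero : g (Sum.inl i) * g b = 0 := hg.vertex i b hib
  rw [hy, h_zero, zero_mul]
  exact zero_mem _

theorem mul_monomial_mem_reducedSpan (hg : IsDualSystem ε g) (a : Gen Γ)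
    (hl : IsDisjointList l) : g a * monomial g l ∈ reducedSpan k g (l.length + 1) := by
  rcases a with i | e
  · exact hg.vertex_mul_monomial_mem_reducedSpan i hl
  by_cases! h : ∀ b ∈ l, Disjoint (support (Sum.inr e)) (support b)
  · exact hg.mul_monomial_mem_reducedSpan_of_disjoint hl h
  obtain ⟨b, hb, heb⟩ := h
  obtain ⟨i, hi⟩ := hg.exists_mul_eq_smul_mul heb
  obtain ⟨y, hy⟩ := hg.exists_mul_monomial_eq hl hb
  have h_vertex : g (Sum.inr e) * monomial g l = ε • (g (Sum.inl i) * monomial g l) := by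
    rw [hy, hy, hi, smul_mul_assoc]
  rw [h_vertex]
  exact Submodule.smul_mem _ _ (hg.vertex_mul_monomial_mem_reducedSpan i hl)

theorem span_range_pow (hg : IsDualSystem ε g) (d : ℕ) :
    Submodule.span k (Set.range g) ^ d = reducedSpan k g d := by
  refine le_antisymm ?_ (Submodule.span_le.mpr ?_)
  · induction d with
    | zero =>
      rw [pow_zero, Submodule.one_le]
      exact Submodule.subset_span ⟨⟨∅, isReduced_empty, rfl⟩, by simp [monomial]⟩
    | succ d ih =>
      rw [pow_succ']
      refine (mul_le_mul_right ih _).trans ?_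
      rw [reducedSpan, Submodule.span_mul_span, Submodule.span_le]
      rintro _ ⟨_, ⟨a, rfl⟩, _, ⟨⟨A, hA, rfl⟩, rfl⟩, rfl⟩
      simpa using hg.mul_monomial_mem_reducedSpan a hA.isDisjointList_toList
  · rintro _ ⟨⟨A, -, rfl⟩, rfl⟩
    simpa only [Finset.length_toList, SetLike.mem_coe] using
      monomial_mem_span_range_pow k g A.toList

theorem finrank_span_range_pow (hg : IsDualSystem ε g)
    (hli : LinearIndependent k fun A : {A : Finset (Gen Γ) // IsReduced A} =>
      monomial g A.1.toList) (d : ℕ) :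
    Module.finrank k ↥(Submodule.span k (Set.range g) ^ d) =
      Nat.card {A : Finset (Gen Γ) // IsReduced A ∧ A.card = d} := by
  classical
  have hli_d : LinearIndependent k fun A : {A : Finset (Gen Γ) // IsReduced A ∧ A.card = d} =>
      monomial g A.1.toList :=
    hli.comp (Subtype.map id fun _ hA => hA.1) (Subtype.map_injective _ Function.injective_id)
  rw [hg.span_range_pow, reducedSpan, finrank_span_eq_card hli_d, Nat.card_eq_fintype_card]

end IsDualSystem

end Spanning

theorem finrank_component (hΓ : NoOverlappingTriangles Γ) (ε : k) (d : ℕ) :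
    Module.finrank k (QuadAlg.component (QuadAlg.dualRel (rel k Γ ε)) d) =
      Nat.card {A : Finset (Gen Γ) // IsReduced A ∧ A.card = d} := by
  rw [QuadAlg.component, range_gen_eq_span]
  exact (isDualSystem_dualGen ε).finrank_span_range_pow (linearIndependent_monomial hΓ ε) d

variable (Γ) in
/-- The members of `W` are pairwise disjoint edges of `Γ`, that is, `W ∈ L_p` for some `p`. -/
def IsEdgeMatching (W : Finset (Sym2 (Fin n))) : Prop :=
  (∀ e ∈ W, e ∈ Γ.edgeSet) ∧ (W : Set (Sym2 (Fin n))).PairwiseDisjoint Sym2.toFinset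

theorem mem_matchings {p : ℕ} {W : Finset (Sym2 (Fin n))} :
    W ∈ matchings Γ p ↔ W.card = p ∧ IsEdgeMatching Γ W := by
  simp only [matchings, IsEdgeMatching, Finset.mem_filter, Finset.mem_univ, true_and,
    Set.PairwiseDisjoint, Set.Pairwise, Function.onFun, Finset.disjoint_left, Sym2.mem_toFinset,
    Finset.mem_coe]

theorem mem_admissible {W : Finset (Sym2 (Fin n))} (hW : ∀ e ∈ W, e ∈ Γ.edgeSet) {m : Fin n} :
    m ∈ admissible Γ W ↔ ∀ e : Γ.edgeSet, e.1 ∈ W → m ∉ e.1 ∧ ¬ Caps m e := by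
  simp only [admissible, Finset.mem_filter, Finset.mem_univ, true_and]
  constructor
  · rintro ⟨h_notMem, h_caps⟩ e he
    refine ⟨h_notMem _ he, fun h => ?_⟩
    obtain ⟨T, rfl, rfl⟩ := h.exists_triangle
    have hba : s(T.b, T.a) ∈ W := Sym2.eq_swap ▸ he
    rcases h_caps _ _ hba T.a_lt_b with h | h | h
    · exact h.not_gt T.b_lt_c
    · exact h T.adj_bc.symm
    · exact h T.adj_ac.symm
  · intro h
    refine ⟨fun e he => (h ⟨e, hW e he⟩ he).1, fun i j hij hji => ?_⟩
    by_contra! h_tri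
    obtain ⟨h_le, hi, hj⟩ := h_tri
    have h_lt : i < m := lt_of_le_of_ne h_le (Γ.ne_of_adj hi).symm
    refine (h ⟨s(i, j), hW _ hij⟩ hij).2 fun v hv => ?_
    rcases Sym2.mem_iff.mp hv with rfl | rfl
    · exact ⟨h_lt, hi.symm⟩
    · exact ⟨hji.trans h_lt, hj.symm⟩

namespace IsEdgeMatching

variable {W : Finset (Sym2 (Fin n))}

theorem card_biUnion (hW : IsEdgeMatching Γ W) :
    (W.biUnion Sym2.toFinset).card = 2 * W.card := by
  have h_two (e) (he : e ∈ W) : e.toFinset.card = 2 :=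
    Sym2.card_toFinset_of_not_isDiag e (Γ.not_isDiag_of_mem_edgeSet (hW.1 e he))
  rw [Finset.card_biUnion hW.2, Finset.sum_congr rfl h_two, Finset.sum_const, smul_eq_mul,
    mul_comm]

theorem two_mul_card_le (hW : IsEdgeMatching Γ W) : 2 * W.card ≤ n := by
  simpa only [hW.card_biUnion, Fintype.card_fin] using (W.biUnion Sym2.toFinset).card_le_univ

theorem card_admissible (hW : IsEdgeMatching Γ W) (hΓ : Γ.CliqueFree 3) :
    (admissible Γ W).card = n - 2 * W.card := by
  have h_caps (m : Fin n) (e : Γ.edgeSet) : ¬ Caps m e := fun h => by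
    obtain ⟨T, -, -⟩ := h.exists_triangle
    exact hΓ _ T.isNClique
  have h_compl : admissible Γ W = (W.biUnion Sym2.toFinset)ᶜ := by
    ext m
    simp only [mem_admissible hW.1, h_caps, not_false_eq_true, and_true, Finset.mem_compl,
      Finset.mem_biUnion, Sym2.mem_toFinset, not_exists, not_and]
    exact ⟨fun h e he => h ⟨e, hW.1 e he⟩ he, fun h e => h e.1⟩
  rw [h_compl, Finset.card_compl, hW.card_biUnion, Fintype.card_fin]

end IsEdgeMatching

/-- The edges in a set of generators. -/
def edges (A : Finset (Gen Γ)) : Finset (Sym2 (Fin n)) :=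
  A.toRight.map (Function.Embedding.subtype _)

theorem edges_subset_edgeSet (A : Finset (Gen Γ)) : ∀ e ∈ edges A, e ∈ Γ.edgeSet := by
  simp +contextual [edges]

theorem coe_mem_edges {A : Finset (Gen Γ)} {e : Γ.edgeSet} :
    e.1 ∈ edges A ↔ Sum.inr e ∈ A := by
  simp [edges]

theorem card_edges_add_card_toLeft (A : Finset (Gen Γ)) :
    (edges A).card + A.toLeft.card = A.card := by
  rw [edges, Finset.card_map, add_comm, Finset.card_toLeft_add_card_toRight]

theorem isReduced_iff (A : Finset (Gen Γ)) :
    IsReduced A ↔ IsEdgeMatching Γ (edges A) ∧ A.toLeft ⊆ admissible Γ (edges A) := by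
  have h_edges := edges_subset_edgeSet A
  simp only [Finset.subset_iff, mem_admissible h_edges, Finset.mem_toLeft, coe_mem_edges]
  constructor
  · rintro ⟨h_disj, h_caps⟩
    refine ⟨⟨h_edges, fun e he f hf hef => ?_⟩, fun m hm e he => ⟨fun hme => ?_, h_caps m e hm he⟩⟩
    · lift e to Γ.edgeSet using h_edges e he
      lift f to Γ.edgeSet using h_edges f hf
      exact h_disj (coe_mem_edges.mp he) (coe_mem_edges.mp hf)
        (by simpa [Subtype.ext_iff] using hef)
    · exact Finset.disjoint_left.mp (h_disj hm he Sum.inl_ne_inr) (mem_support_inl.mpr rfl)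
        (mem_support_inr.mpr hme)
  · rintro ⟨⟨-, h_disj⟩, h_adm⟩
    have h_cross (m e) (hm : Sum.inl m ∈ A) (he : Sum.inr e ∈ A) :
        Disjoint (support (Sum.inl m : Gen Γ)) (support (Sum.inr e)) :=
      Finset.disjoint_singleton_left.mpr fun h => (h_adm hm e he).1 (mem_support_inr.mp h)
    refine ⟨?_, fun m e hm he => (h_adm hm e he).2⟩
    rintro (i | e) ha (j | f) hb hab
    · exact Finset.disjoint_singleton.mpr fun h => hab (congrArg Sum.inl h)
    · exact h_cross i f ha hb
    · exact (h_cross j e hb ha).symm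
    · exact h_disj (coe_mem_edges.mpr ha) (coe_mem_edges.mpr hb)
        fun h => hab (congrArg Sum.inr (Subtype.ext h))

open scoped Classical in
theorem sum_isReduced_of_edges_eq {R : Type*} [CommSemiring R] (x : R) {W : Finset (Sym2 (Fin n))}
    (hW : IsEdgeMatching Γ W) :
    ∑ A : Finset (Gen Γ) with IsReduced A ∧ edges A = W, x ^ A.card =
      x ^ W.card * (1 + x) ^ (admissible Γ W).card := by
  have h_edges (S : Finset (Fin n)) : edges (S.disjSum (W.subtype (· ∈ Γ.edgeSet))) = W := by
    ext e
    simpa [edges] using hW.1 e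
  rw [add_comm 1 x, ← Finset.sum_pow_mul_eq_add_pow, Finset.mul_sum]
  refine Finset.sum_nbij' Finset.toLeft (·.disjSum (W.subtype (· ∈ Γ.edgeSet)))
    (fun A hA => ?_) (fun S hS => ?_) (fun A hA => ?_) (fun S _ => Finset.toLeft_disjSum)
    fun A hA => ?_
  · obtain ⟨h_red, rfl⟩ := (Finset.mem_filter.mp hA).2
    exact Finset.mem_powerset.mpr ((isReduced_iff A).mp h_red).2
  · simpa [isReduced_iff, h_edges, hW] using hS
  · obtain ⟨-, rfl⟩ := (Finset.mem_filter.mp hA).2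
    ext (i | e) <;> simp [coe_mem_edges]
  · obtain ⟨-, rfl⟩ := (Finset.mem_filter.mp hA).2
    rw [one_pow, mul_one, ← pow_add, card_edges_add_card_toLeft]

open scoped Classical in
theorem sum_isReduced {R : Type*} [CommSemiring R] (x : R) :
    ∑ A : Finset (Gen Γ) with IsReduced A, x ^ A.card =
      ∑ p ∈ Finset.range (n / 2 + 1), x ^ p *
        ∑ W ∈ matchings Γ p, (1 + x) ^ (admissible Γ W).card := by
  have h_card (W) (hW : W ∈ Finset.univ.filter (IsEdgeMatching Γ)) :
      W.card ∈ Finset.range (n / 2 + 1) := by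
    have := (Finset.mem_filter.mp hW).2.two_mul_card_le
    rw [Finset.mem_range]
    lia
  have h_edges (A) (hA : A ∈ Finset.univ.filter (IsReduced (Γ := Γ))) :
      edges A ∈ Finset.univ.filter (IsEdgeMatching Γ) := by
    simpa using ((isReduced_iff A).mp (Finset.mem_filter.mp hA).2).1
  calc ∑ A : Finset (Gen Γ) with IsReduced A, x ^ A.card
      = ∑ W with IsEdgeMatching Γ W, x ^ W.card * (1 + x) ^ (admissible Γ W).card := by
        rw [← Finset.sum_fiberwise_of_maps_to h_edges]
        refine Finset.sum_congr rfl fun W hW => ?_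
        rw [Finset.filter_filter, sum_isReduced_of_edges_eq x (Finset.mem_filter.mp hW).2]
    _ = _ := by
        rw [← Finset.sum_fiberwise_of_maps_to h_card]
        refine Finset.sum_congr rfl fun p _ => ?_
        have h_filter : (Finset.univ.filter (IsEdgeMatching Γ)).filter (·.card = p) =
            matchings Γ p := by
          ext W
          simp [mem_matchings, and_comm]
        rw [h_filter, Finset.mul_sum]
        exact Finset.sum_congr rfl fun W hW => by rw [(mem_matchings.mp hW).1]

theorem hilbertSeries_dualRel_rel (hΓ : NoOverlappingTriangles Γ) (ε : k) :
    QuadAlg.hilbertSeries (QuadAlg.dualRel (rel k Γ ε)) =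
      ((∑ p ∈ Finset.range (n / 2 + 1), Polynomial.X ^ p *
          ∑ W ∈ matchings Γ p, (1 + Polynomial.X) ^ (admissible Γ W).card : Polynomial ℕ) :
        PowerSeries ℕ) := by
  classical
  ext d
  rw [← sum_isReduced, QuadAlg.hilbertSeries, PowerSeries.coeff_mk, finrank_component hΓ,
    Polynomial.coeff_coe, Polynomial.finsetSum_coeff, Nat.card_eq_fintype_card,
    Fintype.card_subtype]
  simp only [Polynomial.coeff_X_pow, Finset.sum_boole, Finset.filter_filter, eq_comm, Nat.cast_id]

theorem sum_matchings_of_cliqueFree {R : Type*} [CommSemiring R] (hΓ : Γ.CliqueFree 3) (x : R) :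
    ∑ p ∈ Finset.range (n / 2 + 1), x ^ p * ∑ W ∈ matchings Γ p, (1 + x) ^ (admissible Γ W).card =
      ∑ p ∈ Finset.range (n / 2 + 1), (matchings Γ p).card * x ^ p * (1 + x) ^ (n - 2 * p) := by
  refine Finset.sum_congr rfl fun p _ => ?_
  have h_card (W) (hW : W ∈ matchings Γ p) :
      (1 + x) ^ (admissible Γ W).card = (1 + x) ^ (n - 2 * p) := by
    obtain ⟨rfl, h_match⟩ := mem_matchings.mp hW
    rw [h_match.card_admissible hΓ]
  rw [Finset.sum_congr rfl h_card, Finset.sum_const, nsmul_eq_mul, mul_left_comm, mul_assoc]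

end GraphAlg

theorem proposition4p5 (k : Type*) [Field k] (n : ℕ) (Γ : SimpleGraph (Fin n))
    (hΓ : GraphAlg.NoOverlappingTriangles Γ) :
    (QuadAlg.hilbertSeries (QuadAlg.dualRel (GraphAlg.relQ k Γ)) =
        ((∑ p ∈ Finset.range (n / 2 + 1), Polynomial.X ^ p *
          ∑ W ∈ GraphAlg.matchings Γ p,
            (1 + Polynomial.X) ^ (GraphAlg.admissible Γ W).card : Polynomial ℕ) :
          PowerSeries ℕ) ∧
      QuadAlg.hilbertSeries (QuadAlg.dualRel (GraphAlg.relB k Γ)) =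
        ((∑ p ∈ Finset.range (n / 2 + 1), Polynomial.X ^ p *
          ∑ W ∈ GraphAlg.matchings Γ p,
            (1 + Polynomial.X) ^ (GraphAlg.admissible Γ W).card : Polynomial ℕ) :
          PowerSeries ℕ)) ∧
    (Γ.CliqueFree 3 →
      QuadAlg.hilbertSeries (QuadAlg.dualRel (GraphAlg.relQ k Γ)) =
        ((∑ p ∈ Finset.range (n / 2 + 1), ((GraphAlg.matchings Γ p).card : Polynomial ℕ) *
          Polynomial.X ^ p * (1 + Polynomial.X) ^ (n - 2 * p) : Polynomial ℕ) :
          PowerSeries ℕ) ∧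
      QuadAlg.hilbertSeries (QuadAlg.dualRel (GraphAlg.relB k Γ)) =
        ((∑ p ∈ Finset.range (n / 2 + 1), ((GraphAlg.matchings Γ p).card : Polynomial ℕ) *
          Polynomial.X ^ p * (1 + Polynomial.X) ^ (n - 2 * p) : Polynomial ℕ) :
          PowerSeries ℕ)) := by
  rw [GraphAlg.relQ_eq_rel, GraphAlg.relB_eq_rel, GraphAlg.hilbertSeries_dualRel_rel hΓ,
    GraphAlg.hilbertSeries_dualRel_rel hΓ]
  refine ⟨⟨rfl, rfl⟩, fun h => ?_⟩
  rw [GraphAlg.sum_matchings_of_cliqueFree h]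
  exact ⟨rfl, rfl⟩
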